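/- Let $\mathbb F$ be a field with algebraic closure $\overline{\mathbb F}$, let $k\ge 1$, let $P(x)=\sum_{i=0}^k P_i x^i\in\mathbb F^{n\times n}[x]$ be a matrix polynomial of degree $k$ with nonsingular leading coefficient $P_k$, and let $v\in\mathbb F[x]$ be a scalar polynomial of arbitrary degree. Write $\Lambda(\lambda)=[\lambda^{k-1},\dots,\lambda,1]^T$. *Definitions.* Let $\mathbb{DL}(P,1)$ be the unique pencil $L(\lambda)=\lambda X+Y$ with $X,Y\in\mathbb F^{nk\times nk}$ such that $L(\lambda)(\Lambda(\lambda)\otimes I_n)=e_k\otimes P(\lambda)$ and $(\Lambda(\lambda)^T\otimes I_n)L(\lambda)=e_k^T\otimes P(\lambda)$, where $e_k=[0,\dots,0,1]^T\in\mathbb F^k$. Let $C_P^{(1)}\in\mathbb F^{nk\times nk}$ be the first companion matrix, with first block row $[-P_k^{-1}P_{k-1},\dots,-P_k^{-1}P_0]$, identity blocks $I_n$ on the first block subdiagonal and zero blocks elsewhere. Set $$\mathbb{BDL}(P,v)=\mathbb{DL}(P,1)\,v(C_P^{(1)}).$$ A pencil $L(\lambda)=\lambda X+Y$ with $X,Y\in\mathbb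 F^{nk\times nk}$ is a linearization of $P$ if $L(\lambda)=U(\lambda)\,\mathrm{diag}(P(\lambda),I_{n(k-1)})\,V(\lambda)$ for matrix polynomials $U,V$ whose determinants are nonzero constants; it is a strong linearization of $P$ if, moreover, $\lambda Y+X$ is a linearization of $\lambda^kP(1/\lambda)$. A right (left) eigenpair of a matrix polynomial $R(x)=\sum_{i=0}^g R_ix^i$ of grade $g$ (i.e. of degree at most $g$) is a pair $(x_0,w)$ with $x_0\in\overline{\mathbb F}\cup\{\infty\}$ and $0\ne w\in\overline{\mathbb F}^n$ such that $R(x_0)w=0$ (respectively $w^TR(x_0)=0$), where $R(\infty):=R_g$. *Theorem.* 1. There are a unique $Q\in\mathbb F^{n\times n}[x]$ of grade $k-1$ with $v(x)I_n=A(x)P(x)+Q(x)$ for some matrix polynomial $A$, and a unique $S\in\mathbb F^{n\times n}[x]$ of grade $k-1$ with $v(x)I_n=P(x)B(x)+S(x)$ for some matrix polynomial $B$. Equivalently, writing $L=\mathbb{BDL}(P,v)$, $Q(x)=\sum_{i=0}^{k-1}Q_ix^i$ and $S(x)=\sum_{i=0}^{k-1}S_ix^i$, they are the unique matrix polynomials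 of grade $k-1$ with $$(\Lambda(\lambda)^T\otimes I_n)L(\lambda)=P(\lambda)\,[Q_{k-1},\dots,Q_0],\qquad L(\lambda)(\Lambda(\lambda)\otimes I_n)=\begin{bmatrix}S_{k-1}\\ \vdots\\ S_0\end{bmatrix}P(\lambda).$$ 2. $\mathbb{BDL}(P,v)$ is a strong linearization of $P$ if and only if $P$ (of grade $k$) and $Q$ (of grade $k-1$) share no right eigenpair. 3. $\mathbb{BDL}(P,v)$ is a strong linearization of $P$ if and only if $P$ (of grade $k$) and $S$ (of grade $k-1$) share no left eigenpair. -/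

import Mathlib

open Polynomial Matrix

/-- An `n × n` matrix polynomial over `F`, i.e. an element of `F^{n × n}[x]`. -/
abbrev MatPoly (n : ℕ) (F : Type*) [Field F] := (Matrix (Fin n) (Fin n) F)[X]

/-- The matrix polynomial written as a matrix with polynomial entries. -/
noncomputable def MatPoly.toMatrix {n : ℕ} {F : Type*} [Field F] (P : MatPoly n F) :
    Matrix (Fin n) (Fin n) F[X] :=
  matPolyEquiv.symm P

/-- The matrix polynomial `v(x) I_n` attached to a scalar polynomial `v`. -/
noncomputable def scalarMatPoly (n : ℕ) {F : Type*} [Field F] (v : F[X]) : MatPoly n F :=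
  v.map (Matrix.scalar (Fin n))

/-- The reversal `x^g P(1/x)` of a matrix polynomial of grade `g`. -/
noncomputable def MatPoly.rev {n : ℕ} {F : Type*} [Field F] (g : ℕ) (P : MatPoly n F) :
    MatPoly n F :=
  P.reflect g

/-- A pencil `λ X + Y` whose coefficients are `k × k` block matrices with `n × n` blocks. -/
@[ext]
structure Pencil (k n : ℕ) (F : Type*) where
  X : Matrix (Fin k × Fin n) (Fin k × Fin n) F
  Y : Matrix (Fin k × Fin n) (Fin k × Fin n) F

namespace Pencil

variable {k n : ℕ} {F : Type*} [Field F]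

/-- The pencil `λ X + Y` as a matrix with polynomial entries. -/
noncomputable def toMatrix (L : Pencil k n F) :
    Matrix (Fin k × Fin n) (Fin k × Fin n) F[X] :=
  (Polynomial.X : F[X]) • L.X.map Polynomial.C + L.Y.map Polynomial.C

/-- The reversed pencil `λ Y + X`. -/
def rev (L : Pencil k n F) : Pencil k n F := ⟨L.Y, L.X⟩

/-- The pencil `(λ X + Y) M` for a constant matrix `M`. -/
def mulRight (L : Pencil k n F) (M : Matrix (Fin k × Fin n) (Fin k × Fin n) F) :
    Pencil k n F :=
  ⟨L.X * M, L.Y * M⟩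

end Pencil

/-! ### Linearizations -/

/-- The block diagonal matrix polynomial `diag(P, I_n, …, I_n)` with `k` diagonal blocks. -/
noncomputable def diagWithOnes {n : ℕ} {F : Type*} [Field F] (k : ℕ) (P : MatPoly n F) :
    Matrix (Fin k × Fin n) (Fin k × Fin n) F[X] :=
  Matrix.of fun p q =>
    if p.1 = q.1 then
      (if (p.1 : ℕ) = 0 then P.toMatrix p.2 q.2
        else (1 : Matrix (Fin n) (Fin n) F[X]) p.2 q.2)
    else 0

/-- `L(λ) = U(λ) diag(P(λ), I_{n(k-1)}) V(λ)` with `U`, `V` unimodular. -/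
def IsLinearization {k n : ℕ} {F : Type*} [Field F] (L : Pencil k n F) (P : MatPoly n F) :
    Prop :=
  ∃ U V : Matrix (Fin k × Fin n) (Fin k × Fin n) F[X],
    IsUnit U.det ∧ IsUnit V.det ∧ L.toMatrix = U * diagWithOnes k P * V

/-- `L` is a strong linearization of the grade `k` matrix polynomial `P`: `λ X + Y` is a
linearization of `P` and `λ Y + X` is a linearization of `λ^k P(1/λ)`. -/
def IsStrongLinearization {k n : ℕ} {F : Type*} [Field F] (L : Pencil k n F)
    (P : MatPoly n F) : Prop :=
  IsLinearization L P ∧ IsLinearization L.rev (P.rev k)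

/-! ### Ansatz equations and the double ansatz space

Block index `i : Fin k` belongs to the monomial `x^(k-1-i)`, so that block vectors are ordered
as `[x^(k-1), …, x, 1]`. -/

/-- `Λ(λ) ⊗ I_n` with `Λ(λ) = [λ^(k-1), …, λ, 1]ᵀ`. -/
noncomputable def LambdaKron (k n : ℕ) (F : Type*) [Field F] :
    Matrix (Fin k × Fin n) (Fin n) F[X] :=
  Matrix.of fun p b => if p.2 = b then X ^ (k - 1 - (p.1 : ℕ)) else 0

/-- The constant block column `[S_{k-1}; …; S_0]` of coefficients of `S`. -/
noncomputable def blockColumn (k : ℕ) {n : ℕ} {F : Type*} [Field F] (S : MatPoly n F) :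
    Matrix (Fin k × Fin n) (Fin n) F[X] :=
  Matrix.of fun p b => C (S.coeff (k - 1 - (p.1 : ℕ)) p.2 b)

/-- The constant block row `[Q_{k-1}, …, Q_0]` of coefficients of `Q`. -/
noncomputable def blockRow (k : ℕ) {n : ℕ} {F : Type*} [Field F] (Q : MatPoly n F) :
    Matrix (Fin n) (Fin k × Fin n) F[X] :=
  Matrix.of fun a q => C (Q.coeff (k - 1 - (q.1 : ℕ)) a q.2)

/-- `L(λ) (Λ(λ) ⊗ I) = [S_{k-1}; …; S_0] P(λ)`. In terms of the bivariate polynomials `F`, `G`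
with block coefficients `X`, `Y` this says `F(x,y) x + G(x,y) = S(y) P(x)`. -/
def ColumnAnsatz {k n : ℕ} {F : Type*} [Field F] (P S : MatPoly n F) (L : Pencil k n F) :
    Prop :=
  L.toMatrix * LambdaKron k n F = blockColumn k S * P.toMatrix

/-- `(Λ(λ)ᵀ ⊗ I) L(λ) = P(λ) [Q_{k-1}, …, Q_0]`. In terms of the bivariate polynomials `F`, `G`
with block coefficients `X`, `Y` this says `y F(x,y) + G(x,y) = P(y) Q(x)`. -/
def RowAnsatz {k n : ℕ} {F : Type*} [Field F] (P Q : MatPoly n F) (L : Pencil k n F) :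
    Prop :=
  (LambdaKron k n F)ᵀ * L.toMatrix = P.toMatrix * blockRow k Q

/-- `L ∈ 𝕃₁(P)` with ansatz polynomial `v`, where `v` has degree at most `k - 1`. -/
def MemL1 {k n : ℕ} {F : Type*} [Field F] (P : MatPoly n F) (v : F[X]) (L : Pencil k n F) :
    Prop :=
  v.degree < k ∧ ColumnAnsatz P (scalarMatPoly n v) L

/-- `L ∈ 𝕃₂(P)` with ansatz polynomial `w`, where `w` has degree at most `k - 1`. -/
def MemL2 {k n : ℕ} {F : Type*} [Field F] (P : MatPoly n F) (w : F[X]) (L : Pencil k n F) :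
    Prop :=
  w.degree < k ∧ RowAnsatz P (scalarMatPoly n w) L

/-- `L ∈ 𝔻𝕃(P) = 𝕃₁(P) ∩ 𝕃₂(P)` with (left) ansatz polynomial `v`. -/
def MemDL {k n : ℕ} {F : Type*} [Field F] (P : MatPoly n F) (v : F[X]) (L : Pencil k n F) :
    Prop :=
  MemL1 P v L ∧ ∃ w : F[X], MemL2 P w L

/-- The pencil `𝔻𝕃(P, 1)`, given by the block coefficients of
`F(x,y) = (P(x) - P(y)) / (x - y)` and `G(x,y) = (P(y) x - y P(x)) / (x - y)`: the coefficient
of `y^a x^b` is `P_{a+b+1}` in `F`; in `G` it is `P_0` if `a = b = 0`, `-P_{a+b}` if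
`a, b ≥ 1`, and `0` otherwise. It is the unique pencil in `𝔻𝕃(P)` with ansatz `1`, see
`memDL_one_iff`. -/
def DLone (k : ℕ) {n : ℕ} {F : Type*} [Field F] (P : MatPoly n F) : Pencil k n F where
  X := Matrix.of fun p q =>
    P.coeff ((k - 1 - (p.1 : ℕ)) + (k - 1 - (q.1 : ℕ)) + 1) p.2 q.2
  Y := Matrix.of fun p q =>
    if k - 1 - (p.1 : ℕ) = 0 ∧ k - 1 - (q.1 : ℕ) = 0 then P.coeff 0 p.2 q.2
    else if k - 1 - (p.1 : ℕ) = 0 ∨ k - 1 - (q.1 : ℕ) = 0 then 0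
    else -P.coeff ((k - 1 - (p.1 : ℕ)) + (k - 1 - (q.1 : ℕ))) p.2 q.2

/-- `blockAt f m` is the entry of `f` that belongs to the monomial `x^m` (`0` if `m ≥ k`). -/
def blockAt {k : ℕ} {R : Type*} [Zero R] (f : Fin k → R) (m : ℕ) : R :=
  if h : m < k then f (Fin.rev ⟨m, h⟩) else 0

theorem coeff_sum_blockAt {k : ℕ} {F : Type*} [Field F] (f : Fin k → F) (m : ℕ) :
    (∑ j : Fin k, C (f j) * (X : F[X]) ^ (k - 1 - (j : ℕ))).coeff m = blockAt f m := by
  simp only [finsetSum_coeff, coeff_C_mul, coeff_X_pow, mul_ite, mul_one, mul_zero]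
  unfold blockAt
  split_ifs with h
  · rw [Finset.sum_eq_single (Fin.rev ⟨m, h⟩)]
    · rw [if_pos]
      simp only [Fin.val_rev]
      omega
    · intro j _ hj
      rw [if_neg]
      intro e
      apply hj
      ext
      simp only [Fin.val_rev]
      omega
    · simp
  · apply Finset.sum_eq_zero
    intro j _
    rw [if_neg]
    omega

theorem toMatrix_mul_LambdaKron {k n : ℕ} {F : Type*} [Field F] (L : Pencil k n F)
    (p : Fin k × Fin n) (b : Fin n) :
    (L.toMatrix * LambdaKron k n F) p b =
      X * (∑ j : Fin k, C (L.X p (j, b)) * (X : F[X]) ^ (k - 1 - (j : ℕ))) +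
      ∑ j : Fin k, C (L.Y p (j, b)) * (X : F[X]) ^ (k - 1 - (j : ℕ)) := by
  simp only [Matrix.mul_apply, Fintype.sum_prod_type, LambdaKron, Pencil.toMatrix, Matrix.of_apply,
    mul_ite, mul_zero, Finset.sum_ite_eq', Finset.mem_univ, if_true, Matrix.add_apply,
    Matrix.smul_apply, Matrix.map_apply, smul_eq_mul, Finset.mul_sum, ← Finset.sum_add_distrib]
  refine Finset.sum_congr rfl fun j _ => ?_
  ring

theorem LambdaKron_transpose_mul_toMatrix {k n : ℕ} {F : Type*} [Field F] (L : Pencil k n F)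
    (a : Fin n) (q : Fin k × Fin n) :
    ((LambdaKron k n F)ᵀ * L.toMatrix) a q =
      X * (∑ i : Fin k, C (L.X (i, a) q) * (X : F[X]) ^ (k - 1 - (i : ℕ))) +
      ∑ i : Fin k, C (L.Y (i, a) q) * (X : F[X]) ^ (k - 1 - (i : ℕ)) := by
  simp only [Matrix.mul_apply, Fintype.sum_prod_type, LambdaKron, Pencil.toMatrix, Matrix.of_apply,
    Matrix.transpose_apply,
    ite_mul, zero_mul, Finset.sum_ite_eq', Finset.mem_univ, if_true, Matrix.add_apply,
    Matrix.smul_apply, Matrix.map_apply, smul_eq_mul, Finset.mul_sum, ← Finset.sum_add_distrib]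
  refine Finset.sum_congr rfl fun j _ => ?_
  ring

/-- A pencil is determined by the two products `L(λ) (Λ(λ) ⊗ I)` and `(Λ(λ)ᵀ ⊗ I) L(λ)`. -/
theorem Pencil.ext_of_ansatz {k n : ℕ} {F : Type*} [Field F] {L L' : Pencil k n F}
    (h1 : L.toMatrix * LambdaKron k n F = L'.toMatrix * LambdaKron k n F)
    (h2 : (LambdaKron k n F)ᵀ * L.toMatrix = (LambdaKron k n F)ᵀ * L'.toMatrix) : L = L' := by
  have c0 : ∀ p b, blockAt (fun j => L.Y p (j, b)) 0 = blockAt (fun j => L'.Y p (j, b)) 0 := by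
    intro p b
    have := congrArg (fun M => (M p b).coeff 0) h1
    simpa only [toMatrix_mul_LambdaKron, coeff_add, coeff_sum_blockAt, coeff_X_mul_zero,
      zero_add] using this
  have c1 : ∀ p b m, blockAt (fun j => L.X p (j, b)) m + blockAt (fun j => L.Y p (j, b)) (m + 1) =
      blockAt (fun j => L'.X p (j, b)) m + blockAt (fun j => L'.Y p (j, b)) (m + 1) := by
    intro p b m
    have := congrArg (fun M => (M p b).coeff (m + 1)) h1
    simpa only [toMatrix_mul_LambdaKron, coeff_add, coeff_sum_blockAt, coeff_X_mul] using this
  have r0 : ∀ a q, blockAt (fun i => L.Y (i, a) q) 0 = blockAt (fun i => L'.Y (i, a) q) 0 := by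
    intro p b
    have := congrArg (fun M => (M p b).coeff 0) h2
    simpa only [LambdaKron_transpose_mul_toMatrix, coeff_add, coeff_sum_blockAt, coeff_X_mul_zero,
      zero_add] using this
  have r1 : ∀ a q m, blockAt (fun i => L.X (i, a) q) m + blockAt (fun i => L.Y (i, a) q) (m + 1) =
      blockAt (fun i => L'.X (i, a) q) m + blockAt (fun i => L'.Y (i, a) q) (m + 1) := by
    intro p b m
    have := congrArg (fun M => (M p b).coeff (m + 1)) h2
    simpa only [LambdaKron_transpose_mul_toMatrix, coeff_add, coeff_sum_blockAt,
      coeff_X_mul] using this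
  -- equality of the `Y`-blocks in a block row gives equality of the `X`-blocks in it
  have key : ∀ i : Fin k, (∀ a q, L.Y (i, a) q = L'.Y (i, a) q) →
      ∀ a q, L.X (i, a) q = L'.X (i, a) q := by
    intro i hY a q
    have h := c1 (i, a) q.2 (Fin.rev q.1)
    have e : (fun j => L.Y (i, a) (j, q.2)) = fun j => L'.Y (i, a) (j, q.2) :=
      funext fun j => hY a (j, q.2)
    rw [e] at h
    have h' := add_right_cancel h
    have hr : (⟨((Fin.rev q.1 : Fin k) : ℕ), (Fin.rev q.1).2⟩ : Fin k).rev = q.1 := Fin.rev_rev _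
    simp only [blockAt, (Fin.rev q.1).2, dif_pos, hr] at h'
    exact h'
  have main : ∀ m (hm : m < k), ∀ a q,
      L.Y (Fin.rev ⟨m, hm⟩, a) q = L'.Y (Fin.rev ⟨m, hm⟩, a) q := by
    intro m
    induction m with
    | zero =>
      intro hm a q
      simpa [blockAt, hm] using r0 a q
    | succ m ih =>
      intro hm a q
      have hx := key _ (ih (by omega)) a q
      have h := r1 a q m
      have hm' : m < k := by omega
      simp only [blockAt, hm, hm', dif_pos] at h
      rw [hx] at h
      exact add_left_cancel h
  have hY : ∀ i a q, L.Y (i, a) q = L'.Y (i, a) q := by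
    intro i a q
    have hr : (⟨((Fin.rev i : Fin k) : ℕ), (Fin.rev i).2⟩ : Fin k).rev = i := Fin.rev_rev _
    have h := main (Fin.rev i) (Fin.rev i).2 a q
    rw [hr] at h
    exact h
  refine Pencil.ext ?_ ?_
  · ext p q
    exact key p.1 (hY p.1) p.2 q
  · ext p q
    exact hY p.1 p.2 q

theorem MatPoly.coeff_toMatrix {n : ℕ} {F : Type*} [Field F] (P : MatPoly n F) (a b : Fin n)
    (m : ℕ) : (P.toMatrix a b).coeff m = P.coeff m a b := by
  have h := matPolyEquiv_coeff_apply P.toMatrix m a b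
  rw [MatPoly.toMatrix, AlgEquiv.apply_symm_apply] at h
  exact h.symm

theorem blockAt_DLone_X {k n : ℕ} {F : Type*} [Field F] {P : MatPoly n F}
    (hdeg : P.natDegree ≤ k) (i m : ℕ) (a b : Fin n) :
    (if m < k then P.coeff (i + (k - 1 - (k - (m + 1))) + 1) a b else 0) =
      P.coeff (i + m + 1) a b := by
  split_ifs with h
  · rw [show k - 1 - (k - (m + 1)) = m by omega]
  · rw [coeff_eq_zero_of_natDegree_lt (by omega)]
    rfl

theorem columnAnsatz_DLone {k n : ℕ} {F : Type*} [Field F] {P : MatPoly n F}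
    (hdeg : P.natDegree ≤ k) (hk : 1 ≤ k) : ColumnAnsatz P (scalarMatPoly n 1) (DLone k P) := by
  unfold ColumnAnsatz
  ext p b m
  have hr : (blockColumn k (scalarMatPoly n (1 : F[X])) * P.toMatrix) p b =
      if k - 1 - (p.1 : ℕ) = 0 then P.toMatrix p.2 b else 0 := by
    simp only [Matrix.mul_apply, blockColumn, scalarMatPoly, Polynomial.map_one, coeff_one,
      Matrix.of_apply]
    split_ifs <;> simp [Matrix.one_apply]
  rw [hr, toMatrix_mul_LambdaKron]
  rcases m with _ | m
  · simp only [coeff_add, coeff_sum_blockAt, coeff_X_mul_zero, zero_add, blockAt]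
    rw [dif_pos (by omega)]
    simp only [DLone, Matrix.of_apply, Fin.val_rev]
    split_ifs <;> first | omega | simp [MatPoly.coeff_toMatrix]
  · have hX : blockAt (fun j => (DLone k P).X p (j, b)) m =
        P.coeff (k - 1 - (p.1 : ℕ) + m + 1) p.2 b := by
      rw [← blockAt_DLone_X hdeg]
      simp [blockAt, DLone]
    have hY : blockAt (fun j => (DLone k P).Y p (j, b)) (m + 1) =
        if k - 1 - (p.1 : ℕ) = 0 then 0 else -P.coeff (k - 1 - (p.1 : ℕ) + m + 1) p.2 b := by
      simp only [blockAt, DLone, Matrix.of_apply, Fin.val_rev]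
      by_cases h1 : m + 1 < k
      · rw [dif_pos h1, show k - 1 - (k - (m + 1 + 1)) = m + 1 by omega]
        simp [add_assoc]
      · rw [dif_neg h1]
        split_ifs with h2
        · rfl
        · rw [coeff_eq_zero_of_natDegree_lt (by omega)]
          simp
    rw [coeff_add, coeff_X_mul, coeff_sum_blockAt, coeff_sum_blockAt, hX, hY]
    split_ifs with h
    · simp [h, MatPoly.coeff_toMatrix]
    · simp

theorem rowAnsatz_DLone {k n : ℕ} {F : Type*} [Field F] {P : MatPoly n F}
    (hdeg : P.natDegree ≤ k) (hk : 1 ≤ k) : RowAnsatz P (scalarMatPoly n 1) (DLone k P) := by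
  have hsymm : ∀ i j a b, (DLone k P).X (i, a) (j, b) = (DLone k P).X (j, a) (i, b) ∧
      (DLone k P).Y (i, a) (j, b) = (DLone k P).Y (j, a) (i, b) := by
    intro i j a b
    simp only [DLone, Matrix.of_apply, and_comm, or_comm, add_comm (k - 1 - (i : ℕ)), and_self]
  have hcol := columnAnsatz_DLone hdeg hk
  unfold RowAnsatz
  ext1 a q
  have hr : (P.toMatrix * blockRow k (scalarMatPoly n (1 : F[X]))) a q =
      (blockColumn k (scalarMatPoly n (1 : F[X])) * P.toMatrix) (q.1, a) q.2 := by
    simp only [Matrix.mul_apply, blockColumn, blockRow, scalarMatPoly, Polynomial.map_one,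
      coeff_one, Matrix.of_apply]
    split_ifs <;> simp [Matrix.one_apply]
  rw [hr, ← hcol, toMatrix_mul_LambdaKron, LambdaKron_transpose_mul_toMatrix]
  obtain ⟨j, b⟩ := q
  refine congrArg₂ _ (congrArg _ ?_) ?_
  · exact Finset.sum_congr rfl fun i _ => by rw [(hsymm i j a b).1]
  · exact Finset.sum_congr rfl fun i _ => by rw [(hsymm i j a b).2]

theorem blockColumn_scalar {k n : ℕ} {F : Type*} [Field F] {v : F[X]} (hv : v.degree < k) :
    (LambdaKron k n F)ᵀ * blockColumn k (scalarMatPoly n v) = Matrix.scalar (Fin n) v := by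
  have hs : v = ∑ i : Fin k, C (v.coeff (k - 1 - (i : ℕ))) * X ^ (k - 1 - (i : ℕ)) := by
    ext m
    rw [coeff_sum_blockAt]
    unfold blockAt
    split_ifs with h
    · simp only [Fin.val_rev]
      congr 1
      omega
    · exact coeff_eq_zero_of_degree_lt (lt_of_lt_of_le hv (by exact_mod_cast not_lt.mp h))
  ext1 a b
  simp only [Matrix.mul_apply, Fintype.sum_prod_type, LambdaKron, blockColumn, scalarMatPoly,
    Matrix.transpose_apply, Matrix.of_apply, ite_mul, zero_mul, Finset.sum_ite_eq',
    Finset.mem_univ, if_true, coeff_map, Matrix.scalar_apply, Matrix.diagonal_apply]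
  split_ifs with h
  · conv_rhs => rw [hs]
    exact Finset.sum_congr rfl fun i _ => mul_comm _ _
  · simp

theorem blockRow_scalar {k n : ℕ} {F : Type*} [Field F] {v : F[X]} (hv : v.degree < k) :
    blockRow k (scalarMatPoly n v) * LambdaKron k n F = Matrix.scalar (Fin n) v := by
  rw [← Matrix.transpose_inj, Matrix.transpose_mul]
  have h := blockColumn_scalar (n := n) hv
  have e : (blockRow k (scalarMatPoly n v))ᵀ = blockColumn k (scalarMatPoly n v) := by
    ext1 p b
    simp [blockRow, blockColumn, scalarMatPoly, Matrix.diagonal_apply, eq_comm]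
  rw [e, h]
  simp

/-- In `𝔻𝕃(P)` the left and the right ansatz agree. -/
theorem MemL2.eq_of_memL1 {k n : ℕ} {F : Type*} [Field F] {P : MatPoly n F} (hP : P ≠ 0)
    {v w : F[X]} {L : Pencil k n F} (h1 : MemL1 P v L) (h2 : MemL2 P w L) : w = v := by
  have e : Matrix.scalar (Fin n) v * P.toMatrix = P.toMatrix * Matrix.scalar (Fin n) w := by
    rw [← blockColumn_scalar h1.1, Matrix.mul_assoc, ← h1.2, ← Matrix.mul_assoc, h2.2,
      Matrix.mul_assoc, blockRow_scalar h2.1]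
  have hne : P.toMatrix ≠ 0 := fun h => hP (by
    simpa [MatPoly.toMatrix] using h)
  obtain ⟨a, b, hab⟩ : ∃ a b, P.toMatrix a b ≠ 0 := by
    by_contra! hc
    exact hne (Matrix.ext hc)
  have := congrFun (congrFun e a) b
  simp only [Matrix.scalar_apply, Matrix.diagonal_mul, Matrix.mul_diagonal] at this
  rw [mul_comm] at this
  exact (mul_left_cancel₀ hab this).symm

/-- `DLone k P` is the unique pencil in `𝔻𝕃(P)` with ansatz polynomial `1`. -/
theorem memDL_one_iff {k n : ℕ} {F : Type*} [Field F] {P : MatPoly n F} (hk : 1 ≤ k)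
    (hdeg : P.natDegree = k) (L : Pencil k n F) : MemDL P 1 L ↔ L = DLone k P := by
  have hP : P ≠ 0 := by
    rintro rfl
    simp at hdeg
    omega
  have h1 : (1 : F[X]).degree < k := by
    rw [degree_one]
    exact_mod_cast hk
  constructor
  · rintro ⟨hL1, w, hL2⟩
    obtain rfl := hL2.eq_of_memL1 hP hL1
    exact Pencil.ext_of_ansatz (hL1.2.trans (columnAnsatz_DLone hdeg.le hk).symm)
      (hL2.2.trans (rowAnsatz_DLone hdeg.le hk).symm)
  · rintro rfl
    exact ⟨⟨h1, columnAnsatz_DLone hdeg.le hk⟩, 1, h1, rowAnsatz_DLone hdeg.le hk⟩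

/-! ### The companion matrix and the pencil `𝔹𝔻𝕃(P, v)` -/

/-- The first companion matrix of `P(x) = ∑_{i ≤ k} P_i x^i` with `P_k` invertible: first block
row `-P_k⁻¹ P_{k-1}, …, -P_k⁻¹ P_0`, identity blocks on the block subdiagonal. -/
noncomputable def companion1 (k : ℕ) {n : ℕ} {F : Type*} [Field F] (P : MatPoly n F) :
    Matrix (Fin k × Fin n) (Fin k × Fin n) F :=
  Matrix.of fun p q =>
    if (p.1 : ℕ) = 0 then (-((P.coeff k)⁻¹ * P.coeff (k - 1 - (q.1 : ℕ)))) p.2 q.2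
    else if (p.1 : ℕ) = q.1 + 1 then (1 : Matrix (Fin n) (Fin n) F) p.2 q.2
    else 0

/-- `𝔹𝔻𝕃(P, v) = 𝔻𝕃(P, 1) v(C_P^{(1)})`. -/
noncomputable def BDL (k : ℕ) {n : ℕ} {F : Type*} [Field F] (P : MatPoly n F) (v : F[X]) :
    Pencil k n F :=
  (DLone k P).mulRight (aeval (companion1 k P) v)

/-! ### Remainders -/

/-- `Q` has grade `k - 1` and `v(x) I = A(x) P(x) + Q(x)` for some matrix polynomial `A`. -/
def IsRemainderModLeftIdeal {n : ℕ} {F : Type*} [Field F] (k : ℕ) (P : MatPoly n F) (v : F[X])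
    (Q : MatPoly n F) : Prop :=
  Q.degree < k ∧ ∃ A : MatPoly n F, scalarMatPoly n v = A * P + Q

/-- `S` has grade `k - 1` and `v(x) I = P(x) B(x) + S(x)` for some matrix polynomial `B`. -/
def IsRemainderModRightIdeal {n : ℕ} {F : Type*} [Field F] (k : ℕ) (P : MatPoly n F) (v : F[X])
    (S : MatPoly n F) : Prop :=
  S.degree < k ∧ ∃ B : MatPoly n F, scalarMatPoly n v = P * B + S

/-! ### Eigenpairs -/

/-- The value of a matrix polynomial of grade `g` at a point of `F̄ ∪ {∞}`, where `F̄` is the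
algebraic closure; its value at `∞` is the value at `0` of its reversal, the coefficient of
`x^g`. -/
noncomputable def MatPoly.valueAt {n : ℕ} {F : Type*} [Field F] (g : ℕ) (P : MatPoly n F)
    (x₀ : OnePoint (AlgebraicClosure F)) : Matrix (Fin n) (Fin n) (AlgebraicClosure F) :=
  x₀.elim ((P.coeff g).map (algebraMap F (AlgebraicClosure F)))
    (fun x => P.toMatrix.map (aeval x))

/-- `(x₀, w)` is a (right) eigenpair of the matrix polynomial `P` of grade `g`. -/
def IsRightEigenpair {n : ℕ} {F : Type*} [Field F] (g : ℕ) (P : MatPoly n F)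
    (x₀ : OnePoint (AlgebraicClosure F)) (w : Fin n → AlgebraicClosure F) : Prop :=
  w ≠ 0 ∧ P.valueAt g x₀ *ᵥ w = 0

/-- `(x₀, w)` is a left eigenpair of the matrix polynomial `P` of grade `g`. -/
def IsLeftEigenpair {n : ℕ} {F : Type*} [Field F] (g : ℕ) (P : MatPoly n F)
    (x₀ : OnePoint (AlgebraicClosure F)) (w : Fin n → AlgebraicClosure F) : Prop :=
  w ≠ 0 ∧ w ᵥ* P.valueAt g x₀ = 0

/-- `P` (of grade `g`) and `Q` (of grade `h`) share a right eigenpair. -/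
def ShareRightEigenpair {n : ℕ} {F : Type*} [Field F] (g h : ℕ) (P Q : MatPoly n F) : Prop :=
  ∃ x₀ w, IsRightEigenpair g P x₀ w ∧ IsRightEigenpair h Q x₀ w

/-- `P` (of grade `g`) and `S` (of grade `h`) share a left eigenpair. -/
def ShareLeftEigenpair {n : ℕ} {F : Type*} [Field F] (g h : ℕ) (P S : MatPoly n F) : Prop :=
  ∃ x₀ w, IsLeftEigenpair g P x₀ w ∧ IsLeftEigenpair h S x₀ w

/-! Write C for the first companion matrix and X for the leading coefficient of 𝔻𝕃(P,1). The basic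
fact is 𝔻𝕃(P,1) = X(λI - C) with X invertible (`DLone_Y`, `isUnit_det_DLone_X`). Since v(C) commutes
with C, 𝔹𝔻𝕃(P,v) = X v(C) (λI - C): a constant matrix times the companion pencil (`BDL_eq`).

The companion pencil and its reversal are unimodularly equivalent to diag(P, I, …, I) and diag(rev
P, I, …, I). So 𝔹𝔻𝕃(P,v) is a strong linearization when v(C) is invertible; otherwise the pencil has
determinant zero, whereas det P ≠ 0 (`isStrongLinearization_BDL_iff`). By spectral mapping, v(C) is
invertible exactly when v has no common root with the characteristic polynomial of C, which is det P
up to a unit.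

On the other side, P has no eigenvalue at ∞ because P_k is nonsingular, and if P(x)w = 0 then v I =
A P + Q gives v(x)w = Q(x)w. Hence a shared right eigenpair is again a common root of v and det P;
left eigenpairs and S behave in the same way.

The remainders come from dividing v(λ)I - v(C) by λI - C on either side and compressing the quotient
identity to n × n blocks; the compressions of v(C) are exactly the Q and S of the ansatz equations.
Uniqueness is a degree count based on the invertibility of P_k. -/

/-! ### Determinants of block triangular matrices. -/

/-- The determinant of a matrix that is block triangular for the order of the block indices
pulled back along `β`. -/
theorem det_eq_prod_of_blockTriangular {ι m R : Type*} [Fintype ι] [DecidableEq ι] [Fintype m]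
    [DecidableEq m] [CommRing R] (β : ι → ℕ) (hβ : Function.Injective β)
    (M : Matrix (ι × m) (ι × m) R) (h : ∀ i j a b, β j < β i → M (i, a) (j, b) = 0) :
    M.det = ∏ i, (Matrix.of fun a b => M (i, a) (i, b)).det := by
  let o : LinearOrder ι := LinearOrder.lift' β hβ
  have ht : M.BlockTriangular Prod.fst := by
    rintro ⟨i, a⟩ ⟨j, b⟩ hij
    exact h i j a b hij
  rw [ht.det_fintype]
  refine Finset.prod_congr rfl fun i _ => ?_
  let e : m ≃ {p : ι × m // p.1 = i} :=
    { toFun := fun a => ⟨(i, a), rfl⟩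
      invFun := fun p => p.1.2
      left_inv := fun _ => rfl
      right_inv := by
        rintro ⟨⟨j, a⟩, rfl⟩
        rfl }
  rw [← Matrix.det_submatrix_equiv_self e]
  rfl

/-- A matrix that becomes block triangular with invertible diagonal blocks after a permutation
`ρ` of the block rows has a unit as determinant. -/
theorem isUnit_det_of_blockTriangular {ι m R : Type*} [Fintype ι] [DecidableEq ι] [Fintype m]
    [DecidableEq m] [CommRing R] (β : ι → ℕ) (hβ : Function.Injective β) (ρ : ι → ι)
    (hρ : Function.Injective ρ) (M : Matrix (ι × m) (ι × m) R)
    (h : ∀ i j a b, β j < β i → M (ρ i, a) (j, b) = 0)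
    (hd : ∀ i, IsUnit (Matrix.of fun a b => M (ρ i, a) (i, b)).det) : IsUnit M.det := by
  let σ : Equiv.Perm ι := Equiv.ofBijective ρ (Finite.injective_iff_bijective.mp hρ)
  have h1 := det_eq_prod_of_blockTriangular β hβ
    (M.submatrix (Equiv.prodCongr σ (Equiv.refl m)) id) h
  rw [Matrix.det_permute] at h1
  have h2 : IsUnit (∏ i, (Matrix.of fun a b => M (ρ i, a) (i, b)).det) := by
    rw [IsUnit.prod_univ_iff]
    exact hd
  -- Permuting rows only multiplies the determinant by a sign, so the determinant is a factor of a
  -- unit.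
  exact isUnit_of_mul_isUnit_right (h1.symm ▸ h2)

theorem isUnit_det_neg_one {m R : Type*} [Fintype m] [DecidableEq m] [CommRing R] :
    IsUnit (-1 : Matrix m m R).det := by
  rw [Matrix.det_neg, Matrix.det_one, mul_one]
  exact (isUnit_one.neg).pow _

/-! ### The companion pencil and its reversal as linearizations. -/

section Equivalence

variable {k n : ℕ} {F : Type*} [Field F]

/-- The matrix with block columns `A₀, B_1, …, B_{k-1}`, where `B_j` is the block column of `B`
with index `r j`. -/
def firstColumnReplaced {R : Type*} (A₀ : Matrix (Fin k × Fin n) (Fin n) R)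
    (B : Matrix (Fin k × Fin n) (Fin k × Fin n) R) (r : Fin k → Fin k) :
    Matrix (Fin k × Fin n) (Fin k × Fin n) R :=
  Matrix.of fun p q => if (q.1 : ℕ) = 0 then A₀ p q.2 else B p (r q.1, q.2)

theorem firstColumnReplaced_mul_diagWithOnes (P : MatPoly n F)
    (A₀ : Matrix (Fin k × Fin n) (Fin n) F[X])
    (B : Matrix (Fin k × Fin n) (Fin k × Fin n) F[X]) (r : Fin k → Fin k) :
    firstColumnReplaced A₀ B r * diagWithOnes k P =
      firstColumnReplaced (A₀ * P.toMatrix) B r := by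
  ext1 p q
  simp only [Matrix.mul_apply, firstColumnReplaced, diagWithOnes, Fintype.sum_prod_type,
    Matrix.of_apply]
  rw [Finset.sum_eq_single q.1]
  · simp only [if_true]
    split_ifs <;> simp [Matrix.one_apply]
  · intro i _ hi
    simp [hi]
  · simp

theorem mul_firstColumnReplaced_one {R : Type*} [CommRing R]
    (A : Matrix (Fin k × Fin n) (Fin k × Fin n) R)
    (E₀ : Matrix (Fin k × Fin n) (Fin n) R) (r : Fin k → Fin k) :
    A * firstColumnReplaced E₀ 1 r = firstColumnReplaced (A * E₀) A r := by
  ext1 p q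
  by_cases h : (q.1 : ℕ) = 0
  · simp [Matrix.mul_apply, firstColumnReplaced, h]
  · simp only [Matrix.mul_apply, firstColumnReplaced, h, Matrix.of_apply, if_false,
      Matrix.one_apply, mul_ite, mul_one, mul_zero, Finset.sum_ite_eq', Finset.mem_univ, if_true]

/-- If `A E₀ = G P`, then completing `E₀` and `G` to unimodular matrices by block columns of the
identity and of `A` exhibits `A` as equivalent to `diag(P, I, …, I)`. -/
theorem exists_eq_mul_diagWithOnes_mul {P : MatPoly n F}
    {A : Matrix (Fin k × Fin n) (Fin k × Fin n) F[X]}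
    {E₀ G : Matrix (Fin k × Fin n) (Fin n) F[X]} (r : Fin k → Fin k)
    (h : A * E₀ = G * P.toMatrix) (hE : IsUnit (firstColumnReplaced E₀ 1 r).det)
    (hG : IsUnit (firstColumnReplaced G A r).det) :
    ∃ U V : Matrix (Fin k × Fin n) (Fin k × Fin n) F[X],
      IsUnit U.det ∧ IsUnit V.det ∧ A = U * diagWithOnes k P * V := by
  refine ⟨firstColumnReplaced G A r, (firstColumnReplaced E₀ 1 r)⁻¹, hG, ?_, ?_⟩
  · exact Matrix.isUnit_nonsing_inv_det _ hE
  · rw [firstColumnReplaced_mul_diagWithOnes, ← h, ← mul_firstColumnReplaced_one, Matrix.mul_assoc,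
      Matrix.mul_nonsing_inv _ hE, Matrix.mul_one]

theorem det_diagWithOnes (hk : 1 ≤ k) (P : MatPoly n F) :
    (diagWithOnes k P).det = P.toMatrix.det := by
  rw [det_eq_prod_of_blockTriangular (fun i : Fin k => (i : ℕ)) Fin.val_injective,
    Finset.prod_eq_single ⟨0, hk⟩]
  · simp [diagWithOnes]
    rfl
  · intro i _ hi
    have hi' : (i : ℕ) ≠ 0 := fun e => hi (Fin.ext e)
    simp only [diagWithOnes, Matrix.of_apply, if_true, hi', if_false]
    exact Matrix.det_one
  · simp
  · intro i j a b hij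
    have : i ≠ j := by
      rintro rfl
      exact lt_irrefl _ hij
    simp [diagWithOnes, this]

/-- The block column `e_1 ⊗ Z`. -/
noncomputable def firstBlockColumn (k : ℕ) (Z : Matrix (Fin n) (Fin n) F) :
    Matrix (Fin k × Fin n) (Fin n) F[X] :=
  Matrix.of fun p b => if (p.1 : ℕ) = 0 then Polynomial.C (Z p.2 b) else 0

theorem isUnit_det_map_C {Z : Matrix (Fin n) (Fin n) F} (hZ : IsUnit Z.det) :
    IsUnit (Matrix.of fun a b => (Polynomial.C (Z a b) : F[X])).det := by
  have h := hZ.map (Polynomial.C : F →+* F[X])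
  rwa [RingHom.map_det] at h

theorem firstBlockColumn_mul_apply (Z : Matrix (Fin n) (Fin n) F) (P : MatPoly n F)
    (p : Fin k × Fin n) (b : Fin n) (m : ℕ) :
    ((firstBlockColumn k Z * P.toMatrix) p b).coeff m =
      if (p.1 : ℕ) = 0 then (Z * P.coeff m) p.2 b else 0 := by
  simp only [Matrix.mul_apply, firstBlockColumn, Matrix.of_apply, Polynomial.finsetSum_coeff]
  split_ifs
  · simp only [Polynomial.coeff_C_mul, MatPoly.coeff_toMatrix]
  · simp

/-- `(λ I - C) (Λ ⊗ I) = e_1 ⊗ P_k⁻¹ P`. -/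
theorem charmatrix_companion1_mul_LambdaKron {P : MatPoly n F} (hdeg : P.natDegree = k)
    (hk : 1 ≤ k) (hlead : IsUnit (P.coeff k).det) :
    (companion1 k P).charmatrix * LambdaKron k n F =
      firstBlockColumn k (P.coeff k)⁻¹ * P.toMatrix := by
  have hL : (companion1 k P).charmatrix =
      (⟨1, -companion1 k P⟩ : Pencil k n F).toMatrix := by
    ext1 p q
    simp only [Pencil.toMatrix, Matrix.charmatrix, Matrix.sub_apply, Matrix.add_apply,
      Matrix.scalar_apply, Matrix.diagonal_apply, RingHom.mapMatrix_apply, Matrix.map_apply,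
      Matrix.smul_apply, Matrix.neg_apply, Matrix.one_apply, smul_eq_mul, Polynomial.C_neg]
    split_ifs <;> simp [sub_eq_add_neg]
  rw [hL]
  ext p b m
  rw [toMatrix_mul_LambdaKron, firstBlockColumn_mul_apply]
  obtain ⟨i, a⟩ := p
  have hi := i.2
  simp only [Polynomial.coeff_add, coeff_sum_blockAt]
  have h1 : (X * ∑ j : Fin k, Polynomial.C ((1 : Matrix (Fin k × Fin n) (Fin k × Fin n) F)
      (i, a) (j, b)) * (X : F[X]) ^ (k - 1 - (j : ℕ))).coeff m =
      if m = k - i then (1 : Matrix (Fin n) (Fin n) F) a b else 0 := by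
    rw [Finset.sum_eq_single i]
    · rw [mul_comm, mul_assoc, ← pow_succ, Polynomial.coeff_C_mul, Polynomial.coeff_X_pow,
        show k - 1 - (i : ℕ) + 1 = k - i by omega]
      simp [Matrix.one_apply]
    · intro j _ hj
      simp [hj.symm]
    · simp
  rw [h1]
  by_cases h0 : (i : ℕ) = 0
  · simp only [h0, if_true, blockAt, companion1, Matrix.neg_apply, Matrix.of_apply, Fin.val_rev,
      neg_neg]
    rcases lt_trichotomy m k with h | h | h
    · rw [if_neg (by omega), dif_pos h, show k - 1 - (k - (m + 1)) = m by omega, zero_add]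
    · subst h
      simp [Matrix.nonsing_inv_mul _ hlead]
    · rw [if_neg (by omega), dif_neg (by omega),
        Polynomial.coeff_eq_zero_of_natDegree_lt (n := m) (by omega)]
      simp
  · simp only [h0, if_false, blockAt, companion1, Matrix.neg_apply, Matrix.of_apply, Fin.val_rev]
    by_cases h : m = k - i
    · rw [if_pos h, dif_pos (by omega), if_pos (by omega)]
      simp
    · rw [if_neg h, zero_add]
      split_ifs
      · omega
      · simp
      · rfl

/-- The block column `[1, λ, …, λ^(k-1)]ᵀ ⊗ I`. -/
noncomputable def revLambdaKron (k n : ℕ) (F : Type*) [Field F] :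
    Matrix (Fin k × Fin n) (Fin n) F[X] :=
  Matrix.of fun p b => if p.2 = b then X ^ (p.1 : ℕ) else 0

/-- This is `charmatrix_companion1_mul_LambdaKron` with λ replaced by 1/λ and multiplied by λ^k; the
proof compares coefficients directly. -/
theorem one_sub_X_companion1_mul_revLambdaKron {P : MatPoly n F} (hdeg : P.natDegree = k)
    (hlead : IsUnit (P.coeff k).det) :
    (1 - (X : F[X]) • (companion1 k P).map Polynomial.C) * revLambdaKron k n F =
      firstBlockColumn k (P.coeff k)⁻¹ * (P.rev k).toMatrix := by
  ext p b m
  rw [firstBlockColumn_mul_apply]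
  obtain ⟨i, a⟩ := p
  have hi := i.2
  have h1 : (((1 : Matrix (Fin k × Fin n) (Fin k × Fin n) F[X]) -
      (X : F[X]) • (companion1 k P).map Polynomial.C) * revLambdaKron k n F) (i, a) b =
      revLambdaKron k n F (i, a) b -
        X * ∑ j : Fin k, Polynomial.C (companion1 k P (i, a) (j, b)) * (X : F[X]) ^ (j : ℕ) := by
    rw [Matrix.sub_mul, Matrix.one_mul, Matrix.smul_mul, Matrix.sub_apply, Matrix.smul_apply,
      smul_eq_mul]
    congr 2
    simp only [Matrix.mul_apply, Fintype.sum_prod_type, revLambdaKron, Matrix.map_apply,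
      Matrix.of_apply, mul_ite, mul_zero, Finset.sum_ite_eq', Finset.mem_univ, if_true]
  have h2 : ∀ (f : Fin k → F) (l : ℕ),
      (∑ j : Fin k, Polynomial.C (f j) * (X : F[X]) ^ (j : ℕ)).coeff l =
        if h : l < k then f ⟨l, h⟩ else 0 := by
    intro f l
    simp only [Polynomial.finsetSum_coeff, Polynomial.coeff_C_mul, Polynomial.coeff_X_pow, mul_ite,
      mul_one, mul_zero]
    split_ifs with h
    · rw [Finset.sum_eq_single ⟨l, h⟩]
      · simp
      · intro j _ hj
        rw [if_neg]
        rintro rfl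
        exact hj rfl
      · simp
    · exact Finset.sum_eq_zero fun j _ => if_neg (by omega)
  rw [h1, Polynomial.coeff_sub]
  have h3 : (revLambdaKron k n F (i, a) b).coeff m =
      if m = i then (1 : Matrix (Fin n) (Fin n) F) a b else 0 := by
    simp only [revLambdaKron, Matrix.of_apply, Matrix.one_apply]
    split_ifs <;> simp_all [Polynomial.coeff_X_pow]
  rw [h3]
  rcases m with _ | m
  · rw [Polynomial.coeff_X_mul_zero, sub_zero]
    simp only [eq_comm (a := 0), MatPoly.rev, Polynomial.coeff_reflect,
      Polynomial.revAt_zero, Matrix.nonsing_inv_mul _ hlead]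
  · rw [Polynomial.coeff_X_mul, h2]
    simp only [MatPoly.rev, Polynomial.coeff_reflect]
    by_cases h0 : (i : ℕ) = 0
    · simp only [h0, if_true, companion1, Matrix.of_apply, Nat.succ_ne_zero, if_false, zero_sub]
      split_ifs with h
      · rw [Polynomial.revAt_le (by omega), show k - 1 - m = k - (m + 1) by omega]
        simp
      -- Reflection fixes exponents above k, where P has no coefficients.
      · rw [Polynomial.revAt_eq_self_of_lt (by omega),
          Polynomial.coeff_eq_zero_of_natDegree_lt (n := m + 1) (by omega)]
        simp
    · simp only [h0, if_false, companion1, Matrix.of_apply, eq_comm (b := (i : ℕ))]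
      by_cases h : (i : ℕ) = m + 1
      · rw [dif_pos (by omega)]
        simp [h]
      · simp [h]

theorem charmatrix_companion1_equiv {P : MatPoly n F} (hdeg : P.natDegree = k)
    (hk : 1 ≤ k) (hlead : IsUnit (P.coeff k).det) :
    ∃ U V : Matrix (Fin k × Fin n) (Fin k × Fin n) F[X],
      IsUnit U.det ∧ IsUnit V.det ∧
        (companion1 k P).charmatrix = U * diagWithOnes k P * V := by
  refine exists_eq_mul_diagWithOnes_mul (fun j => ⟨(j : ℕ) - 1, by omega⟩)
    (charmatrix_companion1_mul_LambdaKron hdeg hk hlead) ?_ ?_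
  -- The block columns are Λ, e_1, …, e_{k-1}. Cyclically moving the last block row to the top puts
  -- the entry 1 of Λ and the identity blocks on the diagonal; ordering block 0 last makes the
  -- result triangular.
  · refine isUnit_det_of_blockTriangular (fun i : Fin k => if (i : ℕ) = 0 then k else i) ?_
      (fun i : Fin k => ⟨if (i : ℕ) = 0 then k - 1 else i - 1, by split_ifs <;> omega⟩) ?_ _ ?_ ?_
    · intro i j hij
      have := i.2
      have := j.2
      simp only at hij
      ext
      split_ifs at hij <;> omega
    · intro i j hij
      have := i.2
      have := j.2
      simp only [Fin.mk.injEq] at hij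
      ext
      split_ifs at hij <;> omega
    · intro i j a b hij
      have := i.2
      have := j.2
      simp only [firstColumnReplaced, Matrix.of_apply]
      split_ifs at hij ⊢ with h1 h2 h3 <;> try omega
      all_goals
        rw [Matrix.one_apply_ne]
        intro e
        have := congrArg (fun p => (p.1 : ℕ)) e
        simp only at this
        split_ifs at this
        omega
    · intro i
      convert isUnit_one
      rw [← Matrix.det_one (n := Fin n)]
      congr 1
      ext1 a b
      simp only [firstColumnReplaced, Matrix.of_apply, LambdaKron]
      split_ifs <;> simp_all [Matrix.one_apply]
  -- The block columns are e_1 ⊗ P_k⁻¹ and the first k-1 columns of λI - C, shifted right by one.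
  -- The shift brings the subdiagonal blocks -I onto the diagonal.
  · refine isUnit_det_of_blockTriangular (fun i : Fin k => (i : ℕ)) Fin.val_injective id
      Function.injective_id _ ?_ ?_
    · intro i j a b hij
      have : (i : ℕ) ≠ 0 := by omega
      simp only [firstColumnReplaced, Matrix.of_apply, firstBlockColumn, id, this, if_false]
      split_ifs with h1
      · rfl
      · rw [Matrix.charmatrix_apply_ne]
        · have : (i : ℕ) ≠ j - 1 + 1 := by omega
          simp [companion1, *]
        · simp only [ne_eq, Prod.mk.injEq, Fin.ext_iff, not_and]
          omega
    · intro i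
      by_cases h : (i : ℕ) = 0
      · simp only [firstColumnReplaced, firstBlockColumn, Matrix.of_apply, h, if_true, id]
        exact isUnit_det_map_C (Matrix.isUnit_nonsing_inv_det _ hlead)
      · convert isUnit_det_neg_one (m := Fin n) (R := F[X])
        ext1 a b
        simp only [firstColumnReplaced, Matrix.of_apply, h, if_false, id]
        rw [Matrix.charmatrix_apply_ne]
        · have : (i : ℕ) = i - 1 + 1 := by omega
          simp only [companion1, Matrix.of_apply, h, if_false, ← this, if_true, Matrix.one_apply,
            Matrix.neg_apply]
          split_ifs <;> simp
        · simp only [ne_eq, Prod.mk.injEq, Fin.ext_iff, not_and]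
          omega

theorem one_sub_X_companion1_equiv {P : MatPoly n F} (hdeg : P.natDegree = k)
    (hlead : IsUnit (P.coeff k).det) :
    ∃ U V : Matrix (Fin k × Fin n) (Fin k × Fin n) F[X],
      IsUnit U.det ∧ IsUnit V.det ∧
        1 - (X : F[X]) • (companion1 k P).map Polynomial.C =
          U * diagWithOnes k (P.rev k) * V := by
  refine exists_eq_mul_diagWithOnes_mul id
    (one_sub_X_companion1_mul_revLambdaKron hdeg hlead) ?_ ?_
  -- Lower unitriangular, since the top entry of [1, λ, …]ᵀ is 1; the weight k - i reverses the
  -- order of the blocks.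
  · refine isUnit_det_of_blockTriangular (fun i : Fin k => k - (i : ℕ)) ?_ id Function.injective_id _ ?_ ?_
    · intro i j hij
      have := i.2
      have := j.2
      simp only at hij
      ext
      omega
    · intro i j a b hij
      have := i.2
      have := j.2
      simp only [firstColumnReplaced, Matrix.of_apply, id]
      rw [if_neg (by omega), Matrix.one_apply_ne]
      intro e
      have := congrArg (fun p => (p.1 : ℕ)) e
      simp only [id] at this
      omega
    · intro i
      convert isUnit_one
      rw [← Matrix.det_one (n := Fin n)]
      congr 1
      ext1 a b
      simp only [firstColumnReplaced, Matrix.of_apply, revLambdaKron]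
      split_ifs <;> simp_all [Matrix.one_apply]
  -- Block row 0 may be full, while the remaining rows and columns form a lower bidiagonal matrix.
  -- So block 0 stays first and the others are ordered backwards.
  · refine isUnit_det_of_blockTriangular (fun i : Fin k => if (i : ℕ) = 0 then 0 else k - i) ?_ id
      Function.injective_id _ ?_ ?_
    · intro i j hij
      have := i.2
      have := j.2
      simp only at hij
      ext
      split_ifs at hij <;> omega
    · intro i j a b hij
      have hi : (i : ℕ) ≠ 0 := by
        intro h
        simp [h] at hij
      simp only [hi, if_false] at hij
      simp only [firstColumnReplaced, Matrix.of_apply, firstBlockColumn, id, hi, if_false]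
      split_ifs with h1
      · rfl
      · simp only [h1, if_false] at hij
        have h2 : (i : ℕ) ≠ j + 1 := by omega
        have h3 : i ≠ j := by
          rintro rfl
          omega
        simp [companion1, hi, h2, h3, Matrix.one_apply]
    · intro i
      by_cases h : (i : ℕ) = 0
      · simp only [firstColumnReplaced, firstBlockColumn, Matrix.of_apply, h, if_true, id]
        exact isUnit_det_map_C (Matrix.isUnit_nonsing_inv_det _ hlead)
      · convert isUnit_one
        rw [← Matrix.det_one (n := Fin n)]
        congr 1
        ext1 a b
        simp [firstColumnReplaced, companion1, h, Matrix.one_apply]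

end Equivalence

/-! ### Factorization of 𝔹𝔻𝕃(P,v) and the criterion in terms of v(C). -/

section BDL

variable {k n : ℕ} {F : Type*} [Field F]

/-- The matrix is block Hankel: blocks above the antidiagonal... its antidiagonal blocks are P_k and
on one side of them the index exceeds k, so reversing the block rows makes it triangular. -/
theorem isUnit_det_DLone_X {P : MatPoly n F} (hdeg : P.natDegree = k)
    (hlead : IsUnit (P.coeff k).det) : IsUnit (DLone k P).X.det := by
  refine isUnit_det_of_blockTriangular (fun i : Fin k => (i : ℕ)) Fin.val_injective Fin.rev
    Fin.rev_injective _ ?_ ?_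
  · intro i j a b hij
    have := i.2
    simp only [DLone, Matrix.of_apply, Fin.val_rev]
    rw [Polynomial.coeff_eq_zero_of_natDegree_lt (by omega), Matrix.zero_apply]
  · intro i
    have := i.2
    simp only [DLone, Matrix.of_apply, Fin.val_rev]
    rw [show k - 1 - (k - (i + 1)) + (k - 1 - (i : ℕ)) + 1 = k by omega]
    exact hlead

theorem DLone_X_mul_firstBlockColumn {P : MatPoly n F} (hdeg : P.natDegree = k) (hk : 1 ≤ k)
    (hlead : IsUnit (P.coeff k).det) :
    (DLone k P).X.map Polynomial.C * firstBlockColumn k (P.coeff k)⁻¹ =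
      blockColumn k (scalarMatPoly n (1 : F[X])) := by
  ext1 p b
  obtain ⟨i, a⟩ := p
  have hi := i.2
  simp only [Matrix.mul_apply, Fintype.sum_prod_type, firstBlockColumn, Matrix.of_apply,
    Matrix.map_apply, mul_ite, mul_zero]
  rw [Finset.sum_eq_single ⟨0, hk⟩]
  · simp only [if_true, ← Polynomial.C_mul, ← map_sum, DLone, Matrix.of_apply, blockColumn,
      scalarMatPoly, Polynomial.map_one, Polynomial.coeff_one]
    rw [← Matrix.mul_apply (M := P.coeff (k - 1 - (i : ℕ) + (k - 1 - 0) + 1))]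
    congr 1
    split_ifs with h
    · rw [show k - 1 - (i : ℕ) + (k - 1 - 0) + 1 = k by omega, Matrix.mul_nonsing_inv _ hlead]
    · rw [Polynomial.coeff_eq_zero_of_natDegree_lt
        (n := k - 1 - (i : ℕ) + (k - 1 - 0) + 1) (by omega), Matrix.zero_mul]
  · intro j _ hj
    have hj' : (j : ℕ) ≠ 0 := fun e => hj (Fin.ext e)
    simp [hj']
  · simp

/-- A pencil is determined by its leading coefficient and the product `L(λ) (Λ(λ) ⊗ I)`. -/
theorem Pencil.ext_of_X_of_mul_LambdaKron {L L' : Pencil k n F} (hX : L.X = L'.X)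
    (h : L.toMatrix * LambdaKron k n F = L'.toMatrix * LambdaKron k n F) : L = L' := by
  refine Pencil.ext hX ?_
  ext p ⟨j, b⟩
  have hj := j.2
  have h1 := congrArg (fun M => (M p b).coeff (k - 1 - (j : ℕ))) h
  simp only [toMatrix_mul_LambdaKron, hX, Polynomial.coeff_add, add_right_inj,
    coeff_sum_blockAt, blockAt] at h1
  rw [dif_pos (by omega), dif_pos (by omega)] at h1
  have e : Fin.rev (⟨k - 1 - (j : ℕ), by omega⟩ : Fin k) = j := by
    ext
    simp only [Fin.val_rev]
    omega
  rwa [e] at h1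

theorem map_C_neg_mul (M C : Matrix (Fin k × Fin n) (Fin k × Fin n) F) :
    (-(M * C)).map (Polynomial.C : F → F[X]) =
      -(M.map Polynomial.C * C.map Polynomial.C) := by
  rw [← Matrix.map_mul]
  ext1
  simp only [Matrix.map_apply, Matrix.neg_apply, Polynomial.C_neg]

theorem Pencil.toMatrix_mk_neg_mul (M C : Matrix (Fin k × Fin n) (Fin k × Fin n) F) :
    (⟨M, -(M * C)⟩ : Pencil k n F).toMatrix = M.map Polynomial.C * C.charmatrix := by
  rw [Matrix.charmatrix, Matrix.mul_sub, RingHom.mapMatrix_apply, Matrix.scalar_apply,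
    ← Matrix.smul_one_eq_diagonal, Matrix.mul_smul, Matrix.mul_one, Pencil.toMatrix,
    map_C_neg_mul, sub_eq_add_neg]

theorem Pencil.toMatrix_rev_mk_neg_mul (M C : Matrix (Fin k × Fin n) (Fin k × Fin n) F) :
    (⟨M, -(M * C)⟩ : Pencil k n F).rev.toMatrix =
      M.map Polynomial.C * (1 - (Polynomial.X : F[X]) • C.map Polynomial.C) := by
  rw [Matrix.mul_sub, Matrix.mul_smul, Matrix.mul_one, Pencil.toMatrix, Pencil.rev,
    map_C_neg_mul, smul_neg, sub_eq_neg_add]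

theorem Pencil.toMatrix_mulRight (L : Pencil k n F)
    (M : Matrix (Fin k × Fin n) (Fin k × Fin n) F) :
    (L.mulRight M).toMatrix = L.toMatrix * M.map Polynomial.C := by
  simp only [Pencil.toMatrix, Pencil.mulRight, Matrix.map_mul, Matrix.add_mul, Matrix.smul_mul]

/-- Both 𝔻𝕃(P,1) and X(λI - C) have leading coefficient X and send Λ ⊗ I to e_k ⊗ P, and these two
data determine a pencil. -/
theorem DLone_Y {P : MatPoly n F} (hdeg : P.natDegree = k) (hk : 1 ≤ k)
    (hlead : IsUnit (P.coeff k).det) :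
    (DLone k P).Y = -((DLone k P).X * companion1 k P) := by
  have h : DLone k P = ⟨(DLone k P).X, -((DLone k P).X * companion1 k P)⟩ := by
    refine Pencil.ext_of_X_of_mul_LambdaKron rfl ?_
    rw [Pencil.toMatrix_mk_neg_mul, Matrix.mul_assoc,
      charmatrix_companion1_mul_LambdaKron hdeg hk hlead, ← Matrix.mul_assoc,
      DLone_X_mul_firstBlockColumn hdeg hk hlead]
    exact columnAnsatz_DLone hdeg.le hk
  exact congrArg Pencil.Y h

theorem BDL_eq {P : MatPoly n F} (hdeg : P.natDegree = k) (hk : 1 ≤ k)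
    (hlead : IsUnit (P.coeff k).det) (v : F[X]) :
    BDL k P v = ⟨(DLone k P).X * aeval (companion1 k P) v,
      -((DLone k P).X * aeval (companion1 k P) v * companion1 k P)⟩ := by
  have hc : companion1 k P * aeval (companion1 k P) v =
      aeval (companion1 k P) v * companion1 k P := by
    have h := congrArg (aeval (companion1 k P)) (mul_comm X v)
    simpa using h
  rw [BDL, Pencil.mulRight, DLone_Y hdeg hk hlead, Matrix.neg_mul, Matrix.mul_assoc, hc,
    Matrix.mul_assoc]

theorem exists_unit_charpoly_companion1 {P : MatPoly n F} (hdeg : P.natDegree = k) (hk : 1 ≤ k)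
    (hlead : IsUnit (P.coeff k).det) :
    ∃ u : F[X], IsUnit u ∧ (companion1 k P).charpoly = u * P.toMatrix.det := by
  obtain ⟨U, V, hU, hV, h⟩ := charmatrix_companion1_equiv hdeg hk hlead
  refine ⟨U.det * V.det, hU.mul hV, ?_⟩
  rw [Matrix.charpoly, h, Matrix.det_mul, Matrix.det_mul, det_diagWithOnes hk]
  ring

theorem det_toMatrix_ne_zero {P : MatPoly n F} (hdeg : P.natDegree = k) (hk : 1 ≤ k)
    (hlead : IsUnit (P.coeff k).det) : P.toMatrix.det ≠ 0 := by
  obtain ⟨u, -, h⟩ := exists_unit_charpoly_companion1 hdeg hk hlead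
  intro h0
  exact (companion1 k P).charpoly_monic.ne_zero (by rw [h, h0, mul_zero])

theorem isUnit_det_map_C_iff {ι : Type*} [Fintype ι] [DecidableEq ι] {M : Matrix ι ι F} :
    IsUnit (M.map (Polynomial.C : F → F[X])).det ↔ IsUnit M.det := by
  have h : (M.map (Polynomial.C : F → F[X])).det = Polynomial.C M.det :=
    ((Polynomial.C : F →+* F[X]).map_det M).symm
  rw [h, Polynomial.isUnit_C]

/-- An invertible constant factor X v(C) is absorbed into the left unimodular factor for the
companion pencil. Conversely, being a linearization already suffices: a singular factor would force
det P = 0. -/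
theorem isStrongLinearization_BDL_iff {P : MatPoly n F} (hdeg : P.natDegree = k) (hk : 1 ≤ k)
    (hlead : IsUnit (P.coeff k).det) (v : F[X]) :
    IsStrongLinearization (BDL k P v) P ↔ IsUnit (aeval (companion1 k P) v).det := by
  rw [BDL_eq hdeg hk hlead]
  constructor
  · rintro ⟨⟨U, V, hU, hV, h⟩, -⟩
    rw [Pencil.toMatrix_mk_neg_mul] at h
    have h1 := congrArg Matrix.det h
    rw [Matrix.det_mul, Matrix.det_mul, Matrix.det_mul, det_diagWithOnes hk] at h1
    rw [isUnit_iff_ne_zero]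
    intro h0
    have h2 : (((DLone k P).X * aeval (companion1 k P) v).map
        (Polynomial.C : F → F[X])).det = 0 := by
      have e := (Polynomial.C : F →+* F[X]).map_det ((DLone k P).X * aeval (companion1 k P) v)
      rw [Matrix.det_mul, h0, mul_zero, map_zero] at e
      exact e.symm
    rw [h2, zero_mul] at h1
    exact mul_ne_zero (mul_ne_zero hU.ne_zero (det_toMatrix_ne_zero hdeg hk hlead)) hV.ne_zero
      h1.symm
  · intro hv
    set T := ((DLone k P).X * aeval (companion1 k P) v).map (Polynomial.C : F → F[X]) with hT
    have hX : IsUnit T.det := by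
      rw [hT, isUnit_det_map_C_iff, Matrix.det_mul]
      exact (isUnit_det_DLone_X hdeg hlead).mul hv
    constructor
    · obtain ⟨U, V, hU, hV, h⟩ := charmatrix_companion1_equiv hdeg hk hlead
      refine ⟨T * U, V, by rw [Matrix.det_mul]; exact hX.mul hU, hV, ?_⟩
      rw [Pencil.toMatrix_mk_neg_mul, h, ← Matrix.mul_assoc, ← Matrix.mul_assoc]
    · obtain ⟨U, V, hU, hV, h⟩ := one_sub_X_companion1_equiv hdeg hlead
      refine ⟨T * U, V, by rw [Matrix.det_mul]; exact hX.mul hU, hV, ?_⟩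
      rw [Pencil.toMatrix_rev_mk_neg_mul, h, ← Matrix.mul_assoc, ← Matrix.mul_assoc]

/-- A polynomial `v` evaluated at a matrix over a field is singular exactly when `v` and the
characteristic polynomial have a common root in the algebraic closure. -/
theorem isUnit_det_aeval_iff {ι : Type*} [Fintype ι] [DecidableEq ι] [Nonempty ι]
    (M : Matrix ι ι F) (v : F[X]) :
    IsUnit (aeval M v).det ↔
      ¬ ∃ x : AlgebraicClosure F, aeval x v = 0 ∧ aeval x M.charpoly = 0 := by
  set K := AlgebraicClosure F
  set M' : Matrix ι ι K := M.map (algebraMap F K) with hM'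
  have h1 : aeval M' (v.map (algebraMap F K)) = (aeval M v).map (algebraMap F K) := by
    rw [Polynomial.aeval_map_algebraMap]
    exact Polynomial.aeval_algHom_apply (Algebra.ofId F K).mapMatrix M v
  have h2 : IsUnit (aeval M v).det ↔ (0 : K) ∉ spectrum K (aeval M' (v.map (algebraMap F K))) := by
    rw [spectrum.zero_notMem_iff, h1, Matrix.isUnit_iff_isUnit_det]
    have e : ((aeval M v).map (algebraMap F K)).det = algebraMap F K (aeval M v).det :=
      ((algebraMap F K).map_det _).symm
    rw [e, isUnit_iff_ne_zero, isUnit_iff_ne_zero, ne_eq, ne_eq, map_eq_zero]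
  -- Spectral mapping over the closure: the eigenvalues of v(M) are the v(x) with x an eigenvalue of
  -- M. Nonemptiness of the spectrum makes this valid for constant v as well.
  rw [h2, spectrum.map_polynomial_aeval_of_nonempty _ _
    (spectrum.nonempty_of_isAlgClosed_of_finiteDimensional K M'), not_iff_not]
  simp only [Set.mem_image, Matrix.mem_spectrum_iff_isRoot_charpoly]
  refine exists_congr fun x => ?_
  rw [hM', Matrix.charpoly_map, Polynomial.IsRoot, Polynomial.eval_map_algebraMap,
    Polynomial.eval_map_algebraMap, and_comm]

end BDL

/-! ### Shared eigenpairs as common roots of v and det P. -/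

section Eigenpairs

variable {n : ℕ} {F : Type*} [Field F]

theorem toMatrix_scalarMatPoly (v : F[X]) :
    (scalarMatPoly n v).toMatrix = Matrix.scalar (Fin n) v := by
  ext a b m
  rw [MatPoly.coeff_toMatrix, scalarMatPoly, Polynomial.coeff_map]
  simp only [Matrix.scalar_apply, Matrix.diagonal_apply]
  split_ifs <;> simp

/-- Evaluation of a matrix polynomial at a point of the algebraic closure. -/
noncomputable def evalClosure (x : AlgebraicClosure F) :
    MatPoly n F →+* Matrix (Fin n) (Fin n) (AlgebraicClosure F) :=
  ((aeval x : F[X] →ₐ[F] AlgebraicClosure F).toRingHom.mapMatrix).comp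
    (matPolyEquiv.symm : MatPoly n F ≃ₐ[F] Matrix (Fin n) (Fin n) F[X]).toRingEquiv.toRingHom

theorem valueAt_coe (g : ℕ) (P : MatPoly n F) (x : AlgebraicClosure F) :
    P.valueAt g (x : OnePoint (AlgebraicClosure F)) = evalClosure x P := rfl

theorem det_evalClosure (x : AlgebraicClosure F) (P : MatPoly n F) :
    (evalClosure x P).det = aeval x P.toMatrix.det :=
  ((aeval x : F[X] →ₐ[F] AlgebraicClosure F).toRingHom.map_det P.toMatrix).symm

theorem evalClosure_scalarMatPoly (x : AlgebraicClosure F) (v : F[X]) :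
    evalClosure x (scalarMatPoly n v) = aeval x v • (1 : Matrix (Fin n) (Fin n) _) := by
  have h : evalClosure x (scalarMatPoly n v) =
      (scalarMatPoly n v).toMatrix.map (aeval x) := rfl
  rw [h, toMatrix_scalarMatPoly]
  ext a b
  simp only [Matrix.scalar_apply, Matrix.map_apply, Matrix.diagonal_apply, Matrix.smul_apply,
    Matrix.one_apply]
  split_ifs <;> simp

theorem valueAt_infty_det_ne_zero {k : ℕ} {P : MatPoly n F} (hlead : IsUnit (P.coeff k).det) :
    (P.valueAt k OnePoint.infty).det ≠ 0 := by
  have h := hlead.map (algebraMap F (AlgebraicClosure F))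
  rw [RingHom.map_det] at h
  exact h.ne_zero

/-- If `v I = A P + Q`, then `P` and `Q` share a right eigenpair exactly when `v` and `det P` have
a common root. -/
theorem shareRightEigenpair_iff {k : ℕ} {P Q A : MatPoly n F} {v : F[X]}
    (hlead : IsUnit (P.coeff k).det) (h : scalarMatPoly n v = A * P + Q) :
    ShareRightEigenpair k (k - 1) P Q ↔
      ∃ x : AlgebraicClosure F, aeval x v = 0 ∧ aeval x P.toMatrix.det = 0 := by
  -- On the kernel of P(x) the term A(x)P(x) vanishes, so Q(x) acts there as the scalar v(x).
  have key : ∀ (x : AlgebraicClosure F) w, evalClosure x P *ᵥ w = 0 →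
      aeval x v • w = evalClosure x Q *ᵥ w := by
    intro x w hw
    have e := congrArg (evalClosure x · *ᵥ w) h
    simpa [evalClosure_scalarMatPoly, Matrix.add_mulVec, ← Matrix.mulVec_mulVec, hw,
      Matrix.smul_mulVec] using e
  constructor
  · rintro ⟨x₀, w, ⟨hw, hP⟩, -, hQ⟩
    induction x₀ using OnePoint.rec with
    | infty =>
      exact absurd (Matrix.exists_mulVec_eq_zero_iff.mp ⟨w, hw, hP⟩)
        (valueAt_infty_det_ne_zero hlead)
    | coe x =>
      rw [valueAt_coe] at hP hQ
      have e := key x w hP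
      rw [hQ] at e
      refine ⟨x, (smul_eq_zero.mp e).resolve_right hw, ?_⟩
      rw [← det_evalClosure]
      exact Matrix.exists_mulVec_eq_zero_iff.mp ⟨w, hw, hP⟩
  · rintro ⟨x, hv, hd⟩
    rw [← det_evalClosure] at hd
    obtain ⟨w, hw, hP⟩ := Matrix.exists_mulVec_eq_zero_iff.mpr hd
    refine ⟨(x : OnePoint (AlgebraicClosure F)), w, ⟨hw, hP⟩, hw, ?_⟩
    rw [valueAt_coe, ← key x w hP, hv, zero_smul]

/-- If `v I = P B + S`, then `P` and `S` share a left eigenpair exactly when `v` and `det P` have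
a common root. -/
theorem shareLeftEigenpair_iff {k : ℕ} {P S B : MatPoly n F} {v : F[X]}
    (hlead : IsUnit (P.coeff k).det) (h : scalarMatPoly n v = P * B + S) :
    ShareLeftEigenpair k (k - 1) P S ↔
      ∃ x : AlgebraicClosure F, aeval x v = 0 ∧ aeval x P.toMatrix.det = 0 := by
  have key : ∀ (x : AlgebraicClosure F) w, w ᵥ* evalClosure x P = 0 →
      aeval x v • w = w ᵥ* evalClosure x S := by
    intro x w hw
    have e := congrArg (w ᵥ* evalClosure x ·) h
    simpa [evalClosure_scalarMatPoly, Matrix.vecMul_add, ← Matrix.vecMul_vecMul, hw,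
      Matrix.vecMul_smul] using e
  constructor
  · rintro ⟨x₀, w, ⟨hw, hP⟩, -, hS⟩
    induction x₀ using OnePoint.rec with
    | infty =>
      exact absurd (Matrix.exists_vecMul_eq_zero_iff.mp ⟨w, hw, hP⟩)
        (valueAt_infty_det_ne_zero hlead)
    | coe x =>
      rw [valueAt_coe] at hP hS
      have e := key x w hP
      rw [hS] at e
      refine ⟨x, (smul_eq_zero.mp e).resolve_right hw, ?_⟩
      rw [← det_evalClosure]
      exact Matrix.exists_vecMul_eq_zero_iff.mp ⟨w, hw, hP⟩
  · rintro ⟨x, hv, hd⟩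
    rw [← det_evalClosure] at hd
    obtain ⟨w, hw, hP⟩ := Matrix.exists_vecMul_eq_zero_iff.mpr hd
    refine ⟨(x : OnePoint (AlgebraicClosure F)), w, ⟨hw, hP⟩, hw, ?_⟩
    rw [valueAt_coe, ← key x w hP, hv, zero_smul]

end Eigenpairs

/-! ### Division by P and the ansatz equations. -/

section Remainders

variable {k n : ℕ} {F : Type*} [Field F]

theorem MatPoly.toMatrix_injective : Function.Injective (MatPoly.toMatrix (n := n) (F := F)) :=
  matPolyEquiv.symm.injective

theorem MatPoly.toMatrix_mul_add (P Q R : MatPoly n F) :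
    (P * Q + R).toMatrix = P.toMatrix * Q.toMatrix + R.toMatrix := by
  simp only [MatPoly.toMatrix, map_add, map_mul]

theorem exists_toMatrix_eq (M : Matrix (Fin n) (Fin n) F[X]) :
    ∃ P : MatPoly n F, P.toMatrix = M :=
  matPolyEquiv.symm.surjective M

/-- An invertible leading coefficient cannot annihilate that of A, so degrees add despite zero
divisors. This gives uniqueness of both remainders: two of them differ by a multiple of P of degree
below k. -/
theorem le_degree_mul_of_isUnit_leadingCoeff [Nontrivial (Matrix (Fin n) (Fin n) F)]
    {P A : MatPoly n F} (hdeg : P.natDegree = k) (hlead : IsUnit P.leadingCoeff) (hA : A ≠ 0) :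
    (k : WithBot ℕ) ≤ (A * P).degree ∧ (k : WithBot ℕ) ≤ (P * A).degree := by
  have hP : P ≠ 0 := by
    rintro rfl
    exact hlead.ne_zero (by simp)
  have hk : P.degree = k := by rw [Polynomial.degree_eq_natDegree hP, hdeg]
  have h0 : 0 ≤ A.degree := Polynomial.zero_le_degree_iff.mpr hA
  have hlA : A.leadingCoeff ≠ 0 := Polynomial.leadingCoeff_ne_zero.mpr hA
  constructor
  · rw [Polynomial.degree_mul' (by rwa [ne_eq, hlead.mul_left_eq_zero]), hk]
    exact le_add_of_nonneg_left h0
  · rw [Polynomial.degree_mul' (by rwa [ne_eq, hlead.mul_right_eq_zero]), hk]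
    exact le_add_of_nonneg_right h0

theorem IsRemainderModLeftIdeal.eq [Nontrivial (Matrix (Fin n) (Fin n) F)] {P Q Q' : MatPoly n F}
    {v : F[X]} (hdeg : P.natDegree = k) (hlead : IsUnit P.leadingCoeff)
    (h : IsRemainderModLeftIdeal k P v Q) (h' : IsRemainderModLeftIdeal k P v Q') : Q = Q' := by
  obtain ⟨hQ, A, hA⟩ := h
  obtain ⟨hQ', A', hA'⟩ := h'
  have e : (A - A') * P = Q' - Q := by
    rw [sub_mul, sub_eq_sub_iff_add_eq_add, ← hA, hA', add_comm]
  by_cases h0 : A - A' = 0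
  · rw [h0, zero_mul] at e
    exact (sub_eq_zero.mp e.symm).symm
  · have h1 := (le_degree_mul_of_isUnit_leadingCoeff hdeg hlead h0).1
    rw [e] at h1
    exact absurd (lt_of_le_of_lt (Polynomial.degree_sub_le _ _) (max_lt hQ' hQ)) h1.not_gt

theorem IsRemainderModRightIdeal.eq [Nontrivial (Matrix (Fin n) (Fin n) F)]
    {P S S' : MatPoly n F} {v : F[X]} (hdeg : P.natDegree = k) (hlead : IsUnit P.leadingCoeff)
    (h : IsRemainderModRightIdeal k P v S) (h' : IsRemainderModRightIdeal k P v S') : S = S' := by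
  obtain ⟨hS, B, hB⟩ := h
  obtain ⟨hS', B', hB'⟩ := h'
  have e : P * (B - B') = S' - S := by
    rw [mul_sub, sub_eq_sub_iff_add_eq_add, ← hB, hB', add_comm]
  by_cases h0 : B - B' = 0
  · rw [h0, mul_zero] at e
    exact (sub_eq_zero.mp e.symm).symm
  · have h1 := (le_degree_mul_of_isUnit_leadingCoeff hdeg hlead h0).2
    rw [e] at h1
    exact absurd (lt_of_le_of_lt (Polynomial.degree_sub_le _ _) (max_lt hS' hS)) h1.not_gt

/-- The matrix polynomial of degree less than `k` with prescribed coefficients. -/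
theorem exists_degree_lt_coeff (f : Fin k → Matrix (Fin n) (Fin n) F) :
    ∃ Q : MatPoly n F, Q.degree < k ∧ ∀ i : Fin k, Q.coeff (k - 1 - (i : ℕ)) = f i := by
  refine ⟨∑ m ∈ Finset.range k, Polynomial.monomial m (blockAt f m), ?_, fun i => ?_⟩
  · rw [Polynomial.degree_lt_iff_coeff_zero]
    intro m hm
    rw [Polynomial.finsetSum_coeff]
    refine Finset.sum_eq_zero fun l hl => ?_
    rw [Polynomial.coeff_monomial, if_neg]
    have := Finset.mem_range.mp hl
    omega
  · have hi := i.2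
    rw [Polynomial.finsetSum_coeff, Finset.sum_eq_single (k - 1 - (i : ℕ))]
    · rw [Polynomial.coeff_monomial, if_pos rfl, blockAt, dif_pos (by omega)]
      congr 1
      ext
      simp only [Fin.val_rev]
      omega
    · intro l _ hl
      rw [Polynomial.coeff_monomial, if_neg hl]
    · intro h
      exact absurd (Finset.mem_range.mpr (by omega)) h

theorem exists_blockRow_eq (N : Matrix (Fin n) (Fin k × Fin n) F) :
    ∃ Q : MatPoly n F, Q.degree < k ∧ blockRow k Q = N.map Polynomial.C := by
  obtain ⟨Q, hQ, h⟩ := exists_degree_lt_coeff fun i : Fin k => Matrix.of fun a b => N a (i, b)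
  refine ⟨Q, hQ, ?_⟩
  ext1 a q
  simp [blockRow, h]

theorem exists_blockColumn_eq (N : Matrix (Fin k × Fin n) (Fin n) F) :
    ∃ S : MatPoly n F, S.degree < k ∧ blockColumn k S = N.map Polynomial.C := by
  obtain ⟨S, hS, h⟩ := exists_degree_lt_coeff fun i : Fin k => Matrix.of fun a b => N (i, a) b
  refine ⟨S, hS, ?_⟩
  ext1 p b
  simp [blockColumn, h]

theorem sum_coeff_eq_toMatrix {Q : MatPoly n F} (hQ : Q.degree < k) (a b : Fin n) :
    ∑ j : Fin k, Polynomial.C (Q.coeff (k - 1 - (j : ℕ)) a b) * (X : F[X]) ^ (k - 1 - (j : ℕ)) =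
      Q.toMatrix a b := by
  ext m
  rw [coeff_sum_blockAt, MatPoly.coeff_toMatrix, blockAt]
  split_ifs with h
  · simp only [Fin.val_rev]
    rw [show k - 1 - (k - (m + 1)) = m by omega]
  · rw [Polynomial.coeff_eq_zero_of_degree_lt
      (lt_of_lt_of_le hQ (by exact_mod_cast not_lt.mp h)), Matrix.zero_apply]

theorem blockRow_mul_LambdaKron {Q : MatPoly n F} (hQ : Q.degree < k) :
    blockRow k Q * LambdaKron k n F = Q.toMatrix := by
  ext1 a b
  rw [← sum_coeff_eq_toMatrix hQ]
  simp only [Matrix.mul_apply, Fintype.sum_prod_type, LambdaKron, blockRow, Matrix.of_apply,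
    mul_ite, mul_zero, Finset.sum_ite_eq', Finset.mem_univ, if_true]

theorem LambdaKron_transpose_mul_blockColumn {S : MatPoly n F} (hS : S.degree < k) :
    (LambdaKron k n F)ᵀ * blockColumn k S = S.toMatrix := by
  ext1 a b
  rw [← sum_coeff_eq_toMatrix hS]
  simp only [Matrix.mul_apply, Fintype.sum_prod_type, LambdaKron, blockColumn, Matrix.of_apply,
    Matrix.transpose_apply, ite_mul, zero_mul, Finset.sum_ite_eq', Finset.mem_univ, if_true]
  exact Finset.sum_congr rfl fun i _ => mul_comm _ _

theorem mul_left_cancel_of_det_ne_zero {ι κ R : Type*} [Fintype ι] [DecidableEq ι] [CommRing R]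
    [IsDomain R] {M : Matrix ι ι R} (hM : M.det ≠ 0) {A B : Matrix ι κ R} (h : M * A = M * B) :
    A = B := by
  have h1 := congrArg (M.adjugate * ·) h
  simp only [← Matrix.mul_assoc, Matrix.adjugate_mul, Matrix.smul_mul, Matrix.one_mul] at h1
  ext1 i j
  exact mul_left_cancel₀ hM (congrFun (congrFun h1 i) j)

theorem mul_right_cancel_of_det_ne_zero {ι κ R : Type*} [Fintype ι] [DecidableEq ι] [CommRing R]
    [IsDomain R] {M : Matrix ι ι R} (hM : M.det ≠ 0) {A B : Matrix κ ι R} (h : A * M = B * M) :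
    A = B := by
  rw [← Matrix.transpose_inj, Matrix.transpose_mul, Matrix.transpose_mul] at h
  exact Matrix.transpose_injective
    (mul_left_cancel_of_det_ne_zero (by rwa [Matrix.det_transpose]) h)

/-- `v(λ) I - v(C)` is divisible by `λ I - C` on both sides. -/
theorem exists_smul_one_sub_aeval_eq {ι : Type*} [Fintype ι] [DecidableEq ι]
    (M : Matrix ι ι F) (v : F[X]) :
    ∃ W : Matrix ι ι F[X],
      v • (1 : Matrix ι ι F[X]) - (aeval M v).map Polynomial.C = W * M.charmatrix ∧
      v • (1 : Matrix ι ι F[X]) - (aeval M v).map Polynomial.C = M.charmatrix * W := by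
  set M' : Matrix ι ι F[X] := M.map Polynomial.C with hM'
  have hv : (v.map (algebraMap F F[X])).eval X = v := by
    rw [Polynomial.eval_map_algebraMap, Polynomial.aeval_X_left_apply]
  have hV : aeval M' (v.map (algebraMap F F[X])) = (aeval M v).map Polynomial.C := by
    rw [Polynomial.aeval_map_algebraMap]
    exact Polynomial.aeval_algHom_apply (Algebra.ofId F F[X]).mapMatrix M v
  have hc : aeval M' (X - Polynomial.C (X : F[X])) = -M.charmatrix := by
    rw [map_sub, Polynomial.aeval_X, Polynomial.aeval_C, Matrix.charmatrix, neg_sub]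
    rfl
  -- With a second variable y over F[λ], y - λ divides v(y) - v(λ). Substituting y = M turns y - λ
  -- into -(λI - M), and the cofactor, being a polynomial in M, commutes with it; hence one W serves
  -- both sides.
  obtain ⟨w, hw⟩ : X - Polynomial.C (X : F[X]) ∣
      v.map (algebraMap F F[X]) - Polynomial.C v := by
    have h := Polynomial.X_sub_C_dvd_sub_C_eval (a := (X : F[X])) (p := v.map (algebraMap F F[X]))
    rwa [hv] at h
  have key : (aeval M v).map Polynomial.C - v • (1 : Matrix ι ι F[X]) =
      aeval M' (v.map (algebraMap F F[X]) - Polynomial.C v) := by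
    rw [map_sub, hV, Polynomial.aeval_C, Algebra.algebraMap_eq_smul_one]
  refine ⟨aeval M' w, ?_, ?_⟩
  · rw [← neg_sub, key, hw, mul_comm, map_mul, hc, mul_neg, neg_neg]
  · rw [← neg_sub, key, hw, map_mul, hc, neg_mul, neg_neg]

/-- The left product with Λᵀ ⊗ I is P (e_kᵀ ⊗ I) v(C), and P cancels because det P ≠ 0. So the
coefficients of Q form the last block row of v(C). -/
theorem rowAnsatz_BDL_iff {P Q : MatPoly n F} (hdeg : P.natDegree = k) (hk : 1 ≤ k)
    (hlead : IsUnit (P.coeff k).det) (v : F[X]) :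
    RowAnsatz P Q (BDL k P v) ↔ blockRow k Q =
      blockRow k (scalarMatPoly n (1 : F[X])) * (aeval (companion1 k P) v).map Polynomial.C := by
  have h := rowAnsatz_DLone hdeg.le hk
  rw [RowAnsatz] at h
  rw [RowAnsatz, BDL, Pencil.toMatrix_mulRight, ← Matrix.mul_assoc, h, Matrix.mul_assoc]
  exact ⟨fun e => (mul_left_cancel_of_det_ne_zero (det_toMatrix_ne_zero hdeg hk hlead) e).symm,
    fun e => by rw [e]⟩

/-- Here the product with Λ ⊗ I is X v(C) (e_1 ⊗ P_k⁻¹) P, and P cancels on the right. -/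
theorem columnAnsatz_BDL_iff {P S : MatPoly n F} (hdeg : P.natDegree = k) (hk : 1 ≤ k)
    (hlead : IsUnit (P.coeff k).det) (v : F[X]) :
    ColumnAnsatz P S (BDL k P v) ↔ blockColumn k S =
      ((DLone k P).X * aeval (companion1 k P) v).map Polynomial.C *
        firstBlockColumn k (P.coeff k)⁻¹ := by
  rw [ColumnAnsatz, BDL_eq hdeg hk hlead, Pencil.toMatrix_mk_neg_mul, Matrix.mul_assoc,
    charmatrix_companion1_mul_LambdaKron hdeg hk hlead, ← Matrix.mul_assoc]
  exact ⟨fun e => (mul_right_cancel_of_det_ne_zero (det_toMatrix_ne_zero hdeg hk hlead) e).symm,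
    fun e => by rw [e]⟩

theorem exists_rowAnsatz_BDL {P : MatPoly n F} (hdeg : P.natDegree = k) (hk : 1 ≤ k)
    (hlead : IsUnit (P.coeff k).det) (v : F[X]) :
    ∃ Q : MatPoly n F, Q.degree < k ∧ RowAnsatz P Q (BDL k P v) := by
  have hR : blockRow k (scalarMatPoly n (1 : F[X])) = (Matrix.of fun a (q : Fin k × Fin n) =>
      (scalarMatPoly n (1 : F[X])).coeff (k - 1 - (q.1 : ℕ)) a q.2).map Polynomial.C := rfl
  obtain ⟨Q, hQ, h⟩ := exists_blockRow_eq ((Matrix.of fun a (q : Fin k × Fin n) =>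
    (scalarMatPoly n (1 : F[X])).coeff (k - 1 - (q.1 : ℕ)) a q.2) * aeval (companion1 k P) v)
  refine ⟨Q, hQ, (rowAnsatz_BDL_iff hdeg hk hlead v).mpr ?_⟩
  rw [h, hR, Matrix.map_mul]

theorem exists_columnAnsatz_BDL {P : MatPoly n F} (hdeg : P.natDegree = k) (hk : 1 ≤ k)
    (hlead : IsUnit (P.coeff k).det) (v : F[X]) :
    ∃ S : MatPoly n F, S.degree < k ∧ ColumnAnsatz P S (BDL k P v) := by
  have hG : firstBlockColumn k (P.coeff k)⁻¹ = (Matrix.of fun (p : Fin k × Fin n) b =>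
      if (p.1 : ℕ) = 0 then (P.coeff k)⁻¹ p.2 b else 0).map Polynomial.C := by
    ext1 p b
    simp only [firstBlockColumn, Matrix.map_apply, Matrix.of_apply]
    split_ifs <;> simp
  obtain ⟨S, hS, h⟩ := exists_blockColumn_eq ((DLone k P).X * aeval (companion1 k P) v *
    Matrix.of fun (p : Fin k × Fin n) b => if (p.1 : ℕ) = 0 then (P.coeff k)⁻¹ p.2 b else 0)
  refine ⟨S, hS, (columnAnsatz_BDL_iff hdeg hk hlead v).mpr ?_⟩
  rw [h, hG, Matrix.map_mul]

/-- Multiply v I - v(C) = W(λI - C) by e_kᵀ ⊗ I on the left and Λ ⊗ I on the right. The left side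
becomes v I - Q, and (λI - C)(Λ ⊗ I) = (e_1 ⊗ P_k⁻¹) P exhibits the right side as a left multiple of
P. -/
theorem isRemainderModLeftIdeal_of_rowAnsatz {P Q : MatPoly n F} (hdeg : P.natDegree = k)
    (hk : 1 ≤ k) (hlead : IsUnit (P.coeff k).det) {v : F[X]} (hQ : Q.degree < k)
    (h : RowAnsatz P Q (BDL k P v)) : IsRemainderModLeftIdeal k P v Q := by
  rw [rowAnsatz_BDL_iff hdeg hk hlead] at h
  obtain ⟨W, hW, -⟩ := exists_smul_one_sub_aeval_eq (companion1 k P) v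
  have h1 : (1 : F[X]).degree < k := by
    rw [Polynomial.degree_one]
    exact_mod_cast hk
  have hR : blockRow k (scalarMatPoly n (1 : F[X])) * LambdaKron k n F = 1 := by
    rw [blockRow_scalar h1, map_one]
  obtain ⟨A, hA⟩ := exists_toMatrix_eq
    (blockRow k (scalarMatPoly n (1 : F[X])) * W * firstBlockColumn k (P.coeff k)⁻¹)
  refine ⟨hQ, A, MatPoly.toMatrix_injective ?_⟩
  rw [MatPoly.toMatrix_mul_add, hA, ← blockRow_mul_LambdaKron hQ, h, Matrix.mul_assoc _ _ P.toMatrix,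
    ← charmatrix_companion1_mul_LambdaKron hdeg hk hlead, Matrix.mul_assoc _ W,
    ← Matrix.mul_assoc W, ← hW, Matrix.mul_assoc, ← Matrix.mul_add, ← Matrix.add_mul,
    sub_add_cancel, Matrix.smul_mul, Matrix.one_mul, Matrix.mul_smul, hR, toMatrix_scalarMatPoly,
    Matrix.scalar_apply, Matrix.smul_one_eq_diagonal]

/-- Multiply v I - v(C) = (λI - C)W by (Λᵀ ⊗ I)X on the left and e_1 ⊗ P_k⁻¹ on the right. Since
X(e_1 ⊗ P_k⁻¹) = e_k ⊗ I, the left side is v I - S; since (Λᵀ ⊗ I)X(λI - C) = P (e_kᵀ ⊗ I), the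
right side is P times a matrix polynomial. -/
theorem isRemainderModRightIdeal_of_columnAnsatz {P S : MatPoly n F} (hdeg : P.natDegree = k)
    (hk : 1 ≤ k) (hlead : IsUnit (P.coeff k).det) {v : F[X]} (hS : S.degree < k)
    (h : ColumnAnsatz P S (BDL k P v)) : IsRemainderModRightIdeal k P v S := by
  rw [columnAnsatz_BDL_iff hdeg hk hlead] at h
  obtain ⟨W, -, hW⟩ := exists_smul_one_sub_aeval_eq (companion1 k P) v
  have h1 : (1 : F[X]).degree < k := by
    rw [Polynomial.degree_one]
    exact_mod_cast hk
  have hE : (LambdaKron k n F)ᵀ *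
      ((DLone k P).X.map Polynomial.C * firstBlockColumn k (P.coeff k)⁻¹) = 1 := by
    rw [DLone_X_mul_firstBlockColumn hdeg hk hlead, blockColumn_scalar h1, map_one]
  have hrow : (LambdaKron k n F)ᵀ * ((DLone k P).X.map Polynomial.C *
      (companion1 k P).charmatrix) = P.toMatrix * blockRow k (scalarMatPoly n (1 : F[X])) := by
    rw [← Pencil.toMatrix_mk_neg_mul, ← DLone_Y hdeg hk hlead]
    exact rowAnsatz_DLone hdeg.le hk
  obtain ⟨B, hB⟩ := exists_toMatrix_eq
    (blockRow k (scalarMatPoly n (1 : F[X])) * (W * firstBlockColumn k (P.coeff k)⁻¹))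
  refine ⟨hS, B, MatPoly.toMatrix_injective ?_⟩
  rw [MatPoly.toMatrix_mul_add, hB, ← LambdaKron_transpose_mul_blockColumn hS, h,
    ← Matrix.mul_assoc P.toMatrix, ← hrow, Matrix.map_mul]
  simp only [Matrix.mul_assoc]
  rw [← Matrix.mul_assoc (companion1 k P).charmatrix, ← hW, ← Matrix.mul_add, ← Matrix.mul_add,
    ← Matrix.add_mul, sub_add_cancel, Matrix.smul_mul, Matrix.one_mul, Matrix.mul_smul,
    Matrix.mul_smul, hE, toMatrix_scalarMatPoly, Matrix.scalar_apply, Matrix.smul_one_eq_diagonal]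

theorem isStrongLinearization_BDL_iff_no_common_root [NeZero n] {P : MatPoly n F}
    (hdeg : P.natDegree = k) (hk : 1 ≤ k) (hlead : IsUnit (P.coeff k).det) (v : F[X]) :
    IsStrongLinearization (BDL k P v) P ↔
      ¬ ∃ x : AlgebraicClosure F, aeval x v = 0 ∧ aeval x P.toMatrix.det = 0 := by
  have : NeZero k := ⟨by omega⟩
  rw [isStrongLinearization_BDL_iff hdeg hk hlead, isUnit_det_aeval_iff]
  obtain ⟨u, hu, h⟩ := exists_unit_charpoly_companion1 hdeg hk hlead
  have hu' : ∀ x : AlgebraicClosure F, aeval x u ≠ 0 := fun x => (hu.map (aeval x)).ne_zero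
  simp only [h, map_mul, mul_eq_zero, hu', false_or]

end Remainders

/-! ### The main theorem. -/

theorem mainTheorem6 {F : Type*} [Field F] (n k : ℕ) (hk : 1 ≤ k)
    (P : MatPoly n F) (hdeg : P.natDegree = k) (hlead : IsUnit P.leadingCoeff) (v : F[X]) :
    (∃! Q : MatPoly n F, IsRemainderModLeftIdeal k P v Q) ∧
    (∃! S : MatPoly n F, IsRemainderModRightIdeal k P v S) ∧
    (∀ Q : MatPoly n F, IsRemainderModLeftIdeal k P v Q ↔
      Q.degree < k ∧ RowAnsatz P Q (BDL k P v)) ∧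
    (∀ S : MatPoly n F, IsRemainderModRightIdeal k P v S ↔
      S.degree < k ∧ ColumnAnsatz P S (BDL k P v)) ∧
    (∀ Q : MatPoly n F, IsRemainderModLeftIdeal k P v Q →
      (IsStrongLinearization (BDL k P v) P ↔ ¬ ShareRightEigenpair k (k - 1) P Q)) ∧
    (∀ S : MatPoly n F, IsRemainderModRightIdeal k P v S →
      (IsStrongLinearization (BDL k P v) P ↔ ¬ ShareLeftEigenpair k (k - 1) P S)) := by
  -- For n = 0 the only matrix polynomial is 0, which cannot have degree k ≥ 1.
  have hn : NeZero n := by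
    constructor
    rintro rfl
    rw [Subsingleton.elim P 0, Polynomial.natDegree_zero] at hdeg
    omega
  have hdet : IsUnit (P.coeff k).det := by
    rw [← hdeg]
    exact (Matrix.isUnit_iff_isUnit_det _).mp hlead
  obtain ⟨Q₀, hQ₀, hrow⟩ := exists_rowAnsatz_BDL hdeg hk hdet v
  obtain ⟨S₀, hS₀, hcol⟩ := exists_columnAnsatz_BDL hdeg hk hdet v
  have hQ := isRemainderModLeftIdeal_of_rowAnsatz hdeg hk hdet hQ₀ hrow
  have hS := isRemainderModRightIdeal_of_columnAnsatz hdeg hk hdet hS₀ hcol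
  refine ⟨⟨Q₀, hQ, fun Q h => h.eq hdeg hlead hQ⟩, ⟨S₀, hS, fun S h => h.eq hdeg hlead hS⟩,
    fun Q => ⟨fun h => ?_, fun h => isRemainderModLeftIdeal_of_rowAnsatz hdeg hk hdet h.1 h.2⟩,
    fun S => ⟨fun h => ?_, fun h => isRemainderModRightIdeal_of_columnAnsatz hdeg hk hdet h.1 h.2⟩,
    fun Q h => ?_, fun S h => ?_⟩
  -- Any remainder coincides with the one built from the ansatz equation, so it satisfies that
  -- equation.
  · obtain rfl := h.eq hdeg hlead hQ
    exact ⟨hQ₀, hrow⟩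
  · obtain rfl := h.eq hdeg hlead hS
    exact ⟨hS₀, hcol⟩
  · obtain ⟨-, A, hA⟩ := h
    rw [isStrongLinearization_BDL_iff_no_common_root hdeg hk hdet,
      shareRightEigenpair_iff hdet hA]
  · obtain ⟨-, B, hB⟩ := h
    rw [isStrongLinearization_BDL_iff_no_common_root hdeg hk hdet,
      shareLeftEigenpair_iff hdet hB]
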